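/- **Setting.** Let $\mathcal L$ be a finite set and $T>0$. Let $\mathcal T_{\mathcal L}$ be the set of finite (non-planar) rooted trees with vertices labelled by $\mathcal L$; a forest is a finite multiset $\tau_1\cdots\tau_k$ of such trees (with the empty forest $1$), and $|\cdot|$ denotes the number of vertices. Let $\mathcal A\mathcal T_{\mathcal L}$ be the commutative polynomial algebra over $\mathbb R$ generated by $\mathcal T_{\mathcal L}$, whose monomials are the forests, and let $\mathcal A_n\mathcal T_{\mathcal L}$ be the linear span of the forests of degree $|\sigma|\le n$. Write $[\sigma]_a=B_+^a(\sigma)$ for the tree obtained by attaching the roots of the trees of the forest $\sigma$ to a new root with label $a$, and extend $B_+^a$ linearly. The coproduct $\Delta:\mathcal A\mathcal T_{\mathcal L}\to\mathcal A\mathcal T_{\mathcal L}\otimes\mathcal A\mathcal T_{\mathcal L}$ is the algebra homomorphism with $\Delta([\sigma]_a)=1\otimes[\sigma]_a+(B_+^a\otimes\mathrm{id})\Delta(\sigma)$, and $\Delta'(x)=\Delta(x)-1\otimes x-x\otimes 1$. In particular $\Delta'\tau=\sum'\tau^{(1)}\otimes\tau^{(2)}$, a finite sum (with multiplicity) of tensor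 products of non-empty forests, for every tree $\tau$. For $\gamma>0$ the function $q_\gamma$ is multiplicative on forests and is given on trees by $q_\gamma(\tau)=1$ if $|\tau|\le 1/\gamma$ and $$q_\gamma(\tau)=\frac1{2^{\gamma|\tau|}-2}\sum{}' q_\gamma(\tau^{(1)})\,q_\gamma(\tau^{(2)})\qquad\text{if }|\tau|>1/\gamma .$$ Let $\mathcal C_2$ be the space of functions $g:[0,T]^2\to\mathbb R$, $(t,s)\mapsto g_{ts}$, with $g_{tt}=0$ for all $t$, and let $\mathcal C_2^+=\mathcal C_2\oplus\mathbb R e$ with $e\equiv1$, an algebra under the pointwise product. Put $(\delta g)_{tus}=g_{ts}-g_{tu}-g_{us}$ and $\|g\|_\mu=\sup_{s\ne t}|g_{ts}|/|t-s|^\mu\in[0,\infty]$. For a linear map $X$ into $\mathcal C_2^+$ put $X^{x\otimes y}_{tus}=X^x_{tu}X^y_{us}$, extended linearly. A *branched rough path* of roughness $\gamma$ is a unital algebra homomorphism $X:\mathcal A\mathcal T_{\mathcal L}\to\mathcal C_2^+$ with $X^\tau\in\mathcal C_2$ for all trees $\tau$, such that $\delta X^x=X^{\Delta'x}$ for all $x\in\mathcal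 A\mathcal T_{\mathcal L}$ and such that there are constants $A\ge0$ and $B\in[0,1]$ with $\|X^\sigma\|_{\gamma|\sigma|}\le BA^{|\sigma|}q_\gamma(\sigma)$ for all non-empty forests $\sigma$. A *partial homomorphism* of degree $n$ is a linear map $X:\mathcal A_n\mathcal T_{\mathcal L}\to\mathcal C_2^+$ with $X^1=e$, with $X^{\sigma\rho}=X^\sigma X^\rho$ (pointwise product) for all forests with $|\sigma|+|\rho|\le n$, and with $X^\tau\in\mathcal C_2$ for all trees with $|\tau|\le n$. **Theorem (extension theorem).** Let $n\ge 0$ be an integer, $\gamma>0$ with $\gamma(n+1)>1$, $A\ge0$ and $B\in[0,1]$. Let $X:\mathcal A_n\mathcal T_{\mathcal L}\to\mathcal C_2^+$ be a partial homomorphism of degree $n$ such that $\delta X^x=X^{\Delta' x}$ for all $x\in\mathcal A_n\mathcal T_{\mathcal L}$ and $$\|X^\tau\|_{\gamma|\tau|}\le B A^{|\tau|}q_\gamma(\tau)\qquad\text{for all trees }\tau\text{ with }|\tau|\le n.$$ Then there is exactly one branched rough path $Y:\mathcal A\mathcal T_{\mathcal L}\to\mathcal C_2^+$ of roughness $\gamma$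 with $Y^x=X^x$ for all $x\in\mathcal A_n\mathcal T_{\mathcal L}$. Moreover, with the same constants $A$ and $B$, $$\|Y^\tau\|_{\gamma|\tau|}\le B A^{|\tau|}q_\gamma(\tau)\qquad\text{for all trees }\tau\in\mathcal T_{\mathcal L}.$$ -/

import Mathlib

open scoped TensorProduct ENNReal

namespace Branched

universe u

/-! ### Labelled rooted trees and forests -/

/-- Planar rooted trees with vertices labelled by `L`: a root label and the ordered list of
the branches at the root. -/
inductive PlanarTree (L : Type u) : Type u
  | node : L → List (PlanarTree L) → PlanarTree L

/-- Reordering the branches at one vertex of a planar tree. -/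
inductive PlanarTree.Reorder {L : Type u} : PlanarTree L → PlanarTree L → Prop
  | perm (a : L) {l l' : List (PlanarTree L)} (h : l.Perm l') : Reorder (.node a l) (.node a l')
  | branch (a : L) (l₁ l₂ : List (PlanarTree L)) {t t' : PlanarTree L} (h : Reorder t t') :
      Reorder (.node a (l₁ ++ t :: l₂)) (.node a (l₁ ++ t' :: l₂))

/-- `L`-labelled rooted trees: planar trees up to the order of the branches at each vertex. -/
def LTree (L : Type u) : Type u := Quot (@PlanarTree.Reorder L)

/-- Forests: finite unordered collections (with multiplicity) of trees.  `0` is the empty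
forest and `+` is the juxtaposition of forests. -/
abbrev Forest (L : Type u) : Type u := Multiset (LTree L)

variable {L : Type u}

mutual
/-- Number of vertices of a planar tree. -/
def PlanarTree.size : PlanarTree L → ℕ
  | .node _ l => 1 + PlanarTree.sizeList l
/-- Number of vertices of a list of planar trees. -/
def PlanarTree.sizeList : List (PlanarTree L) → ℕ
  | [] => 0
  | t :: l => PlanarTree.size t + PlanarTree.sizeList l
end

/-- The tree represented by a planar tree. -/
def LTree.mk (t : PlanarTree L) : LTree L := Quot.mk _ t

theorem PlanarTree.sizeList_append (l₁ l₂ : List (PlanarTree L)) :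
    sizeList (l₁ ++ l₂) = sizeList l₁ + sizeList l₂ := by
  induction l₁ with
  | nil => simp [sizeList]
  | cons t l ih => simp [sizeList, ih, add_assoc]

theorem PlanarTree.sizeList_perm {l l' : List (PlanarTree L)} (h : l.Perm l') :
    sizeList l = sizeList l' := by
  induction h with
  | nil => rfl
  | cons t _ ih => simp [sizeList, ih]
  | swap t t' l => simp [sizeList]; omega
  | trans _ _ ih₁ ih₂ => exact ih₁.trans ih₂

theorem PlanarTree.Reorder.size_eq {t t' : PlanarTree L} (h : Reorder t t') :
    t.size = t'.size := by
  induction h with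
  | perm a h => simp [size, sizeList_perm h]
  | branch a l₁ l₂ _ ih => simp [size, sizeList_append, sizeList, ih]

/-- A planar representative of a tree. -/
noncomputable def LTree.out (τ : LTree L) : PlanarTree L := Quot.out τ

theorem LTree.mk_out (τ : LTree L) : LTree.mk τ.out = τ := Quot.out_eq τ

/-- The degree `|τ|` of a tree: its number of vertices. -/
def LTree.size : LTree L → ℕ := Quot.lift PlanarTree.size fun _ _ h => h.size_eq

/-- The degree `|σ|` of a forest: its total number of vertices. -/
def Forest.size (σ : Forest L) : ℕ := (σ.map LTree.size).sum

/-- The tree `[σ]_a`, obtained by attaching the roots of the trees in `σ` to a new root with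
label `a`.  (It does not depend on the chosen representatives, see `graft_map_mk`.) -/
noncomputable def graft (a : L) (σ : Forest L) : LTree L :=
  LTree.mk (.node a (σ.map LTree.out).toList)

theorem LTree.mk_node_congr (a : L) {l l' : List (PlanarTree L)}
    (h : List.Forall₂ (fun t t' => LTree.mk t = LTree.mk t') l l') (l₀ : List (PlanarTree L)) :
    LTree.mk (.node a (l₀ ++ l)) = LTree.mk (.node a (l₀ ++ l')) := by
  induction h generalizing l₀ with
  | nil => rfl
  | @cons t t' l l' ht _ ih =>
    have h1 : LTree.mk (.node a (l₀ ++ t :: l)) = LTree.mk (.node a (l₀ ++ t' :: l)) := by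
      have := Quot.eqvGen_exact ht
      clear ht
      induction this with
      | rel _ _ h => exact Quot.sound (.branch a l₀ l h)
      | refl => rfl
      | symm _ _ _ ih => exact ih.symm
      | trans _ _ _ _ _ ih₁ ih₂ => exact ih₁.trans ih₂
    have h2 := ih (l₀ ++ [t'])
    simp only [List.append_assoc, List.singleton_append] at h2
    exact h1.trans h2

theorem graft_map_mk (a : L) (l : List (PlanarTree L)) :
    graft a (l.map LTree.mk : List (LTree L)) = LTree.mk (.node a l) := by
  have h1 : LTree.mk (.node a (((l.map LTree.mk : List (LTree L)) : Forest L).map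
      LTree.out).toList) = LTree.mk (.node a ((l.map LTree.mk).map LTree.out)) := by
    refine Quot.sound (.perm a ?_)
    rw [← Multiset.coe_eq_coe, Multiset.coe_toList, Multiset.map_coe]
  refine h1.trans ?_
  refine LTree.mk_node_congr a ?_ []
  rw [List.map_map, List.forall₂_map_left_iff]
  exact List.forall₂_same.2 fun t _ => LTree.mk_out _

/-! ### The coproduct -/

mutual
/-- The terms of the coproduct of a tree, listed with multiplicity: the recursion is
`Δ τ = 1 ⊗ τ + (B₊ᵃ ⊗ id) (Δ (τ₁ ⋯ τ_k))` for `τ = [τ₁ ⋯ τ_k]_a`. -/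
noncomputable def PlanarTree.terms : PlanarTree L → Multiset (Forest L × Forest L)
  | .node a l => (0, {LTree.mk (.node a l)}) ::ₘ
      (PlanarTree.termsList l).map fun p => ({graft a p.1}, p.2)
/-- The terms of the coproduct of a list of trees, using `Δ (τ σ) = Δ τ Δ σ`. -/
noncomputable def PlanarTree.termsList : List (PlanarTree L) → Multiset (Forest L × Forest L)
  | [] => {(0, 0)}
  | t :: l => (PlanarTree.terms t ×ˢ PlanarTree.termsList l).map fun p => p.1 + p.2
end

theorem map_add_product_left_comm (u v w : Multiset (Forest L × Forest L)) :
    (u ×ˢ (v ×ˢ w).map (fun p => p.1 + p.2)).map (fun p => p.1 + p.2)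
      = (v ×ˢ (u ×ˢ w).map (fun p => p.1 + p.2)).map (fun p => p.1 + p.2) := by
  simp only [SProd.sprod, Multiset.product, Multiset.map_bind, Multiset.map_map,
    Function.comp_def]
  rw [Multiset.bind_bind]
  simp only [add_left_comm]

theorem PlanarTree.termsList_perm {l l' : List (PlanarTree L)} (h : l.Perm l') :
    termsList l = termsList l' := by
  induction h with
  | nil => rfl
  | cons t _ ih => simp [termsList, ih]
  | swap t t' l => simp only [termsList]; exact map_add_product_left_comm _ _ _
  | trans _ _ ih₁ ih₂ => exact ih₁.trans ih₂

theorem PlanarTree.termsList_append_congr (l₁ : List (PlanarTree L))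
    {l l' : List (PlanarTree L)} (h : termsList l = termsList l') :
    termsList (l₁ ++ l) = termsList (l₁ ++ l') := by
  induction l₁ with
  | nil => exact h
  | cons t l₁ ih => simp [termsList, ih]

theorem PlanarTree.Reorder.terms_eq {t t' : PlanarTree L} (h : Reorder t t') :
    t.terms = t'.terms := by
  induction h with
  | perm a h =>
    rw [terms, terms, termsList_perm h]
    congr 3
    exact Quot.sound (.perm a h)
  | @branch a l₁ l₂ t t' h ih =>
    have : termsList (l₁ ++ t :: l₂) = termsList (l₁ ++ t' :: l₂) :=
      termsList_append_congr l₁ (by rw [termsList, termsList, ih])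
    rw [terms, terms, this]
    congr 3
    exact Quot.sound (.branch a l₁ l₂ h)

/-- The terms `(τ⁽¹⁾, τ⁽²⁾)` of the coproduct `Δ τ = ∑ τ⁽¹⁾ ⊗ τ⁽²⁾` of a tree, listed with
multiplicity. -/
noncomputable def LTree.terms : LTree L → Multiset (Forest L × Forest L) :=
  Quot.lift PlanarTree.terms fun _ _ h => h.terms_eq

/-- The terms of the reduced coproduct `Δ' τ = Δ τ - 1 ⊗ τ - τ ⊗ 1` of a tree. -/
noncomputable def LTree.reducedTerms (τ : LTree L) : Multiset (Forest L × Forest L) :=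
  open scoped Classical in τ.terms.filter fun p => p.1 ≠ 0 ∧ p.2 ≠ 0

/-- The commutative polynomial algebra over `ℝ` generated by the labelled trees. -/
abbrev TreeAlg (L : Type u) : Type u := MvPolynomial (LTree L) ℝ

/-- A forest `τ₁ ⋯ τ_k` as a monomial of the tree algebra. -/
noncomputable def Forest.mon (σ : Forest L) : TreeAlg L := (σ.map MvPolynomial.X).prod

/-- The coproduct: the algebra homomorphism whose value on trees is given by `LTree.terms`. -/
noncomputable def coproduct : TreeAlg L →ₐ[ℝ] TreeAlg L ⊗[ℝ] TreeAlg L :=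
  MvPolynomial.aeval fun τ : LTree L =>
    (τ.terms.map fun p => Forest.mon p.1 ⊗ₜ[ℝ] Forest.mon p.2).sum

/-- The reduced coproduct `Δ' x = Δ x - 1 ⊗ x - x ⊗ 1`. -/
noncomputable def reducedCoproduct (x : TreeAlg L) : TreeAlg L ⊗[ℝ] TreeAlg L :=
  coproduct x - 1 ⊗ₜ[ℝ] x - x ⊗ₜ[ℝ] 1

/-- The linear map `B₊ᵃ` with `B₊ᵃ (τ₁ ⋯ τ_k) = [τ₁ ⋯ τ_k]_a`. -/
noncomputable def bPlus (a : L) : TreeAlg L →ₗ[ℝ] TreeAlg L :=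
  (MvPolynomial.basisMonomials (LTree L) ℝ).constr ℝ fun m =>
    MvPolynomial.X (graft a (Finsupp.toMultiset m))

theorem Forest.mon_eq_monomial (σ : Forest L) :
    Forest.mon σ = open scoped Classical in MvPolynomial.monomial (Multiset.toFinsupp σ) 1 := by
  classical
  induction σ using Multiset.induction with
  | empty => simp [Forest.mon]
  | cons τ σ ih =>
    rw [← Multiset.singleton_add, map_add, Multiset.toFinsupp_singleton, ← one_mul (1 : ℝ),
      ← MvPolynomial.monomial_mul]
    simp only [Forest.mon, Multiset.singleton_add, Multiset.map_cons, Multiset.prod_cons] at *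
    rw [ih]
    rfl

theorem bPlus_mon (a : L) (σ : Forest L) :
    bPlus a (Forest.mon σ) = MvPolynomial.X (graft a σ) := by
  classical
  rw [Forest.mon_eq_monomial, bPlus]
  have := (MvPolynomial.basisMonomials (LTree L) ℝ).constr_basis ℝ
    (fun m => (MvPolynomial.X (graft a (Finsupp.toMultiset m)) : TreeAlg L))
    (Multiset.toFinsupp σ)
  rw [MvPolynomial.coe_basisMonomials, Multiset.toFinsupp_toMultiset] at this
  convert this

theorem coproduct_X (τ : LTree L) : coproduct (MvPolynomial.X τ)
    = (τ.terms.map fun p => Forest.mon p.1 ⊗ₜ[ℝ] Forest.mon p.2).sum :=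
  MvPolynomial.aeval_X _ _

theorem Forest.mon_add (σ ρ : Forest L) :
    Forest.mon (σ + ρ) = Forest.mon σ * Forest.mon ρ := by simp [Forest.mon]

theorem coproduct_list (l : List (PlanarTree L)) :
    coproduct (Forest.mon (l.map LTree.mk : List (LTree L)))
      = ((PlanarTree.termsList l).map fun p => Forest.mon p.1 ⊗ₜ[ℝ] Forest.mon p.2).sum := by
  induction l with
  | nil => simp [Forest.mon, PlanarTree.termsList, Algebra.TensorProduct.one_def]
  | cons t l ih =>
    have h1 : Forest.mon ((t :: l).map LTree.mk : List (LTree L))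
        = MvPolynomial.X (LTree.mk t) * Forest.mon (l.map LTree.mk : List (LTree L)) := by
      simp [Forest.mon]
    rw [h1, map_mul, ih, coproduct_X, PlanarTree.termsList]
    change (((PlanarTree.terms t).map _).sum) * _ = _
    simp only [SProd.sprod, Multiset.product, Multiset.map_bind, Multiset.map_map,
      Function.comp_def, Multiset.sum_bind, Prod.fst_add, Prod.snd_add, Forest.mon_add,
      ← Algebra.TensorProduct.tmul_mul_tmul, Multiset.sum_map_mul_left, Multiset.sum_map_mul_right]

/-- The recursion `Δ τ = 1 ⊗ τ + (B₊ᵃ ⊗ id) (Δ σ)` for `τ = [σ]_a`, which characterises `Δ`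
among algebra homomorphisms. -/
theorem coproduct_graft (a : L) (σ : Forest L) :
    coproduct (MvPolynomial.X (graft a σ)) = 1 ⊗ₜ[ℝ] MvPolynomial.X (graft a σ)
      + (bPlus a).rTensor (TreeAlg L) (coproduct (Forest.mon σ)) := by
  induction σ using Quot.ind with
  | mk l =>
    have : ∃ m : List (PlanarTree L), m.map LTree.mk = l :=
      ⟨l.map LTree.out, by
        rw [List.map_map]
        conv_rhs => rw [← List.map_id l]
        exact List.map_congr_left fun t _ => LTree.mk_out t⟩
    obtain ⟨m, rfl⟩ := this
    change coproduct (MvPolynomial.X (graft a ((m.map LTree.mk : List (LTree L)) : Forest L)))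
      = 1 ⊗ₜ[ℝ] MvPolynomial.X (graft a ((m.map LTree.mk : List (LTree L)) : Forest L))
      + (bPlus a).rTensor (TreeAlg L)
          (coproduct (Forest.mon ((m.map LTree.mk : List (LTree L)) : Forest L)))
    rw [coproduct_list, coproduct_X, graft_map_mk]
    change ((PlanarTree.terms (.node a m)).map _).sum = _
    rw [PlanarTree.terms, Multiset.map_cons, Multiset.sum_cons, map_multiset_sum,
      Multiset.map_map, Multiset.map_map]
    simp [Function.comp_def, Forest.mon]
    simp [← Forest.mon.eq_1, bPlus_mon]

/-- The subspace spanned by the forests of degree at most `n`. -/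
noncomputable def TreeAlgLE (L : Type u) (n : ℕ) : Submodule ℝ (TreeAlg L) :=
  Submodule.span ℝ {x | ∃ σ : Forest L, σ.size ≤ n ∧ x = Forest.mon σ}

theorem Forest.mon_mem {n : ℕ} {σ : Forest L} (h : σ.size ≤ n) :
    Forest.mon σ ∈ TreeAlgLE L n := Submodule.subset_span ⟨σ, h, rfl⟩

theorem LTree.X_mem {n : ℕ} {τ : LTree L} (h : τ.size ≤ n) :
    (MvPolynomial.X τ : TreeAlg L) ∈ TreeAlgLE L n :=
  Submodule.subset_span ⟨{τ}, by simpa [Forest.size] using h, by simp [Forest.mon]⟩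

/-! ### The weights `q_γ` -/

theorem Forest.size_add (σ ρ : Forest L) : (σ + ρ).size = σ.size + ρ.size := by
  simp [Forest.size]

theorem LTree.size_pos (τ : LTree L) : 0 < τ.size := by
  induction τ using Quot.ind with
  | mk t => cases t; simp [LTree.size, PlanarTree.size]

theorem Forest.size_pos {σ : Forest L} (h : σ ≠ 0) : 0 < σ.size := by
  obtain ⟨τ, hτ⟩ := Multiset.exists_mem_of_ne_zero h
  obtain ⟨ρ, rfl⟩ := Multiset.exists_cons_of_mem hτ
  have := τ.size_pos
  simp [Forest.size]; omega

theorem LTree.size_le_of_mem {σ : Forest L} {τ : LTree L} (h : τ ∈ σ) : τ.size ≤ σ.size :=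
  Multiset.single_le_sum (fun _ _ => Nat.zero_le _) _ (Multiset.mem_map_of_mem _ h)

theorem graft_size (a : L) (σ : Forest L) : (graft a σ).size = 1 + σ.size := by
  induction σ using Quot.ind with
  | mk l =>
    have : ∃ m : List (PlanarTree L), m.map LTree.mk = l :=
      ⟨l.map LTree.out, by
        rw [List.map_map]
        conv_rhs => rw [← List.map_id l]
        exact List.map_congr_left fun t _ => LTree.mk_out t⟩
    obtain ⟨m, rfl⟩ := this
    change (graft a ((m.map LTree.mk : List (LTree L)) : Forest L)).size = _
    rw [graft_map_mk]
    change 1 + PlanarTree.sizeList m = _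
    congr 1
    induction m with
    | nil => rfl
    | cons t m ih => rw [PlanarTree.sizeList, ih]; rfl

mutual
theorem PlanarTree.terms_size : ∀ (t : PlanarTree L), ∀ p ∈ t.terms,
    p.1.size + p.2.size = t.size
  | .node a l, p, hp => by
    rw [PlanarTree.terms, Multiset.mem_cons, Multiset.mem_map] at hp
    rcases hp with rfl | ⟨r, hr, rfl⟩
    · simp only [Forest.size, Multiset.map_zero, Multiset.sum_zero, Multiset.map_singleton,
        Multiset.sum_singleton, zero_add]
      rfl
    · have := PlanarTree.termsList_size l r hr
      have h2 := graft_size a r.1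
      simp only [Forest.size, Multiset.map_singleton, Multiset.sum_singleton,
        PlanarTree.size] at *
      omega
theorem PlanarTree.termsList_size : ∀ (l : List (PlanarTree L)), ∀ p ∈ PlanarTree.termsList l,
    p.1.size + p.2.size = PlanarTree.sizeList l
  | [], p, hp => by
    rw [PlanarTree.termsList, Multiset.mem_singleton] at hp
    subst hp; rfl
  | t :: l, p, hp => by
    rw [PlanarTree.termsList, Multiset.mem_map] at hp
    obtain ⟨⟨r, r'⟩, hr, rfl⟩ := hp
    rw [Multiset.mem_product] at hr
    have h1 := PlanarTree.terms_size t r hr.1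
    have h2 := PlanarTree.termsList_size l r' hr.2
    simp only [Prod.fst_add, Prod.snd_add, Forest.size_add, PlanarTree.sizeList] at *
    omega
end

theorem LTree.terms_size (τ : LTree L) : ∀ p ∈ τ.terms, p.1.size + p.2.size = τ.size := by
  induction τ using Quot.ind with
  | mk t => exact t.terms_size

theorem LTree.reducedTerms_size_lt {τ : LTree L} {p : Forest L × Forest L}
    (h : p ∈ τ.reducedTerms) : p.1.size < τ.size ∧ p.2.size < τ.size := by
  classical
  rw [LTree.reducedTerms, Multiset.mem_filter] at h
  have h0 := τ.terms_size p h.1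
  have h1 := Forest.size_pos h.2.1
  have h2 := Forest.size_pos h.2.2
  omega

/-- The function `q_γ` on trees: `q_γ(τ) = 1` for `|τ| ≤ 1/γ`, and otherwise
`q_γ(τ) = (2 ^ (γ |τ|) - 2)⁻¹ ∑' q_γ(τ⁽¹⁾) q_γ(τ⁽²⁾)`, the sum being over the terms of the
reduced coproduct and `q_γ` being multiplicative on forests. -/
noncomputable def qTree (γ : ℝ) (τ : LTree L) : ℝ :=
  open scoped Classical in
  if (τ.size : ℝ) ≤ 1 / γ then 1
  else 1 / ((2 : ℝ) ^ (γ * τ.size) - 2) *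
    (τ.reducedTerms.attach.map fun p =>
      (p.1.1.attach.map fun ρ => qTree γ ρ.1).prod *
        (p.1.2.attach.map fun ρ => qTree γ ρ.1).prod).sum
termination_by τ.size
decreasing_by
  · exact (LTree.size_le_of_mem ρ.2).trans_lt (LTree.reducedTerms_size_lt p.2).1
  · exact (LTree.size_le_of_mem ρ.2).trans_lt (LTree.reducedTerms_size_lt p.2).2

/-- The function `q_γ` on forests, `q_γ(τ₁ ⋯ τ_k) = q_γ(τ₁) ⋯ q_γ(τ_k)`. -/
noncomputable def q (γ : ℝ) (σ : Forest L) : ℝ := (σ.map (qTree γ)).prod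

theorem qTree_eq_one {γ : ℝ} {τ : LTree L} (h : (τ.size : ℝ) ≤ 1 / γ) : qTree γ τ = 1 := by
  rw [qTree, if_pos h]

theorem qTree_eq {γ : ℝ} {τ : LTree L} (h : ¬ (τ.size : ℝ) ≤ 1 / γ) :
    qTree γ τ = 1 / ((2 : ℝ) ^ (γ * τ.size) - 2) *
      (τ.reducedTerms.map fun p => q γ p.1 * q γ p.2).sum := by
  rw [qTree, if_neg h]
  congr 2
  have (σ : Forest L) : (σ.attach.map fun ρ => qTree γ ρ.1).prod = q γ σ := by
    rw [q, ← Multiset.attach_map_val' σ (qTree γ)]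
  simp only [this]
  exact Multiset.attach_map_val' τ.reducedTerms (fun p => q γ p.1 * q γ p.2)

/-! ### The reduced coproduct through its terms -/

theorem filter_prod_aux (u v : Multiset (Forest L × Forest L)) [DecidableEq (Forest L)] :
    ((u ×ˢ v).map fun p => p.1 + p.2).filter (fun p => p.2 = 0)
      = ((u.filter fun p => p.2 = 0) ×ˢ (v.filter fun p => p.2 = 0)).map fun p => p.1 + p.2 := by
  induction u using Multiset.induction with
  | empty => simp
  | cons a u ih =>
    rw [Multiset.cons_product, Multiset.map_add, Multiset.filter_add, ih]
    by_cases h : a.2 = 0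
    · simp only [Multiset.filter_cons_of_pos (s := u) (p := fun p => p.2 = 0) h,
        Multiset.cons_product, Multiset.map_add, Multiset.map_map, Multiset.filter_map,
        Function.comp_def, Prod.snd_add, h, zero_add]
    · simp only [Multiset.filter_cons_of_neg (s := u) (p := fun p => p.2 = 0) h,
        Multiset.map_map, Multiset.filter_map,
        Function.comp_def, Prod.snd_add, add_eq_zero, h, false_and]
      simp

mutual
theorem terms_right [DecidableEq (Forest L)] : ∀ t : PlanarTree L,
    t.terms.filter (fun p => p.2 = 0) = {({LTree.mk t}, 0)}
  | .node a l => by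
    rw [PlanarTree.terms, Multiset.filter_cons_of_neg _ (by simp), Multiset.filter_map]
    simp only [Function.comp_def]
    rw [termsList_right l, Multiset.map_singleton, graft_map_mk]
theorem termsList_right [DecidableEq (Forest L)] : ∀ l : List (PlanarTree L),
    (PlanarTree.termsList l).filter (fun p => p.2 = 0)
      = {(((l.map LTree.mk : List (LTree L)) : Forest L), 0)}
  | [] => by
    rw [PlanarTree.termsList, Multiset.filter_singleton, if_pos rfl]; rfl
  | t :: l => by
    rw [PlanarTree.termsList, filter_prod_aux, terms_right t, termsList_right l,
      Multiset.product_singleton, Multiset.map_singleton]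
    rfl
end

theorem terms_left [DecidableEq (Forest L)] (t : PlanarTree L) :
    t.terms.filter (fun p => p.1 = 0) = {(0, {LTree.mk t})} := by
  obtain ⟨a, l⟩ := t
  rw [PlanarTree.terms, Multiset.filter_cons_of_pos _ (by rfl), Multiset.filter_map]
  simp

/-- `Δ τ` consists of `1 ⊗ τ`, `τ ⊗ 1` and the terms of the reduced coproduct. -/
theorem LTree.terms_eq (τ : LTree L) :
    τ.terms = (0, {τ}) ::ₘ ({τ}, 0) ::ₘ τ.reducedTerms := by
  classical
  induction τ using Quot.ind with
  | mk t =>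
    have h1 := Multiset.filter_add_not (fun p : Forest L × Forest L => p.1 = 0) t.terms
    have h2 := Multiset.filter_add_not (fun p : Forest L × Forest L => p.2 = 0)
      (t.terms.filter fun p => ¬ p.1 = 0)
    have h3 : (t.terms.filter fun p => ¬ p.1 = 0).filter (fun p => p.2 = 0)
        = {({LTree.mk t}, 0)} := by
      rw [Multiset.filter_comm, terms_right, Multiset.filter_singleton, if_pos (by simp)]
    rw [h3, Multiset.filter_filter] at h2
    rw [terms_left, ← h2] at h1
    have h4 : (LTree.mk t).reducedTerms
        = t.terms.filter fun p => ¬ p.2 = 0 ∧ ¬ p.1 = 0 :=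
      Multiset.filter_congr fun p _ => and_comm
    change t.terms = (0, {LTree.mk t}) ::ₘ ({LTree.mk t}, 0) ::ₘ (LTree.mk t).reducedTerms
    rw [Multiset.singleton_add, Multiset.singleton_add] at h1
    rw [h4]
    exact h1.symm

theorem reducedCoproduct_X (τ : LTree L) : reducedCoproduct (MvPolynomial.X τ)
    = (τ.reducedTerms.map fun p => Forest.mon p.1 ⊗ₜ[ℝ] Forest.mon p.2).sum := by
  rw [reducedCoproduct, coproduct_X, τ.terms_eq]
  simp [Forest.mon]

/-- The reduced coproduct maps the span of the forests of degree at most `n` into its tensor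
square. -/
theorem reducedCoproduct_mem {n : ℕ} (x : TreeAlg L) (hx : x ∈ TreeAlgLE L n) :
    reducedCoproduct x ∈ LinearMap.range
    (TensorProduct.map (TreeAlgLE L n).subtype (TreeAlgLE L n).subtype) := by
  have key : ∀ x ∈ TreeAlgLE L n, ∀ y ∈ TreeAlgLE L n, x ⊗ₜ[ℝ] y ∈ LinearMap.range
    (TensorProduct.map (TreeAlgLE L n).subtype (TreeAlgLE L n).subtype) := fun x hx y hy =>
      ⟨⟨x, hx⟩ ⊗ₜ ⟨y, hy⟩, by simp⟩
  have one : (1 : TreeAlg L) ∈ TreeAlgLE L n :=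
    Submodule.subset_span ⟨0, Nat.zero_le _, by simp [Forest.mon]⟩
  refine sub_mem (sub_mem ?_ (key _ one _ hx)) (key _ hx _ one)
  induction hx using Submodule.span_induction with
  | zero => simp
  | add x y _ _ h1 h2 => rw [map_add]; exact add_mem h1 h2
  | smul c x _ h => rw [map_smul]; exact Submodule.smul_mem _ _ h
  | mem x h =>
    obtain ⟨σ, hσ, rfl⟩ := h
    induction σ using Quot.ind with
    | mk l =>
    have : ∃ m : List (PlanarTree L), m.map LTree.mk = l :=
      ⟨l.map LTree.out, by
        rw [List.map_map]
        conv_rhs => rw [← List.map_id l]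
        exact List.map_congr_left fun t _ => LTree.mk_out t⟩
    obtain ⟨m, rfl⟩ := this
    have e := coproduct_list m
    erw [e]
    refine multiset_sum_mem _ ?_
    intro a ha
    obtain ⟨p, hp, rfl⟩ := Multiset.mem_map.1 ha
    have h1 := PlanarTree.termsList_size m p hp
    have h2 : Forest.size ((m.map LTree.mk : List (LTree L)) : Forest L) = PlanarTree.sizeList m := by
      clear * -
      induction m with
      | nil => rfl
      | cons t m ih => rw [PlanarTree.sizeList, ← ih]; rfl
    have h3 : Forest.size ((m.map LTree.mk : List (LTree L)) : Forest L) ≤ n := hσ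
    exact key _ (Forest.mon_mem (by omega)) _ (Forest.mon_mem (by omega))

/-! ### Increments -/

/-- Functions `(t, s) ↦ g_{ts}` on `[0,T]²`, with the pointwise algebra structure `∘`.  The unit
is the function `e` with `e_{ts} = 1`. -/
abbrev Fun2 (T : ℝ) : Type := Set.Icc (0 : ℝ) T → Set.Icc (0 : ℝ) T → ℝ

/-- The space `𝒞₂` of `2`-increments: functions on `[0,T]²` vanishing on the diagonal. -/
def Incr2 (T : ℝ) : Submodule ℝ (Fun2 T) where
  carrier := {g | ∀ t, g t t = 0}
  add_mem' := fun ha hb t => by simp [ha t, hb t]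
  zero_mem' := fun _ => rfl
  smul_mem' := fun c g hg t => by simp [hg t]

/-- The coboundary `(δ g)_{tus} = g_{ts} - g_{tu} - g_{us}`. -/
def coboundary {T : ℝ} (g : Fun2 T) (t u s : Set.Icc (0 : ℝ) T) : ℝ := g t s - g t u - g u s

/-- The Hölder norm `‖g‖_μ = sup_{s,t} |g_{ts}| / |t - s|^μ`, with values in `[0, ∞]`. -/
noncomputable def holderNorm {T : ℝ} (μ : ℝ) (g : Fun2 T) : ℝ≥0∞ :=
  ⨆ (t : Set.Icc (0 : ℝ) T) (s : Set.Icc (0 : ℝ) T),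
    ENNReal.ofReal (|g t s| / |(t : ℝ) - (s : ℝ)| ^ μ)

/-- Evaluation at `(t, s)` as a linear map. -/
def evalAt {T : ℝ} (t s : Set.Icc (0 : ℝ) T) : Fun2 T →ₗ[ℝ] ℝ where
  toFun g := g t s
  map_add' _ _ := rfl
  map_smul' _ _ := rfl

/-- The extension of a linear map `X` into functions on `[0,T]²` to the tensor square through
the exterior product: `X^{x ⊗ y}_{tus} = X^x_{tu} X^y_{us}`. -/
noncomputable def extProd {T : ℝ} {V : Type*} [AddCommGroup V] [Module ℝ V]
    (X : V →ₗ[ℝ] Fun2 T) (t u s : Set.Icc (0 : ℝ) T) : V ⊗[ℝ] V →ₗ[ℝ] ℝ :=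
  TensorProduct.lift
    ((LinearMap.mul ℝ ℝ).compl₁₂ (evalAt t u ∘ₗ X) (evalAt u s ∘ₗ X))

/-! ### Branched rough paths -/

/-- `X` is a homomorphism from the whole tree algebra to increments that satisfies
`δ X^x = X^{Δ' x}` and `‖X^σ‖_{γ|σ|} ≤ B A^{|σ|} q_γ(σ)` for every nonempty forest `σ`, with some
constants `A ≥ 0` and `B ∈ [0,1]`. -/
structure IsBranchedRoughPath {T : ℝ} (γ : ℝ) (X : TreeAlg L →ₐ[ℝ] Fun2 T) : Prop where
  mem_incr : ∀ τ : LTree L, X (MvPolynomial.X τ) ∈ Incr2 T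
  delta : ∀ (x : TreeAlg L) (t u s : Set.Icc (0 : ℝ) T),
    coboundary (X x) t u s = extProd X.toLinearMap t u s (reducedCoproduct x)
  bound : ∃ A B : ℝ, 0 ≤ A ∧ 0 ≤ B ∧ B ≤ 1 ∧ ∀ σ : Forest L, σ ≠ 0 →
    holderNorm (γ * σ.size) (X σ.mon) ≤ ENNReal.ofReal (B * A ^ σ.size * q γ σ)

/-- `X` is a partial homomorphism, defined on the span of the forests of degree at most `n`,
with `δ X^x = X^{Δ' x}`.  Here `Δ' x` lies in the tensor square of that span, and
`X^{Δ' x}` is the value at the corresponding element `w` of this tensor square. -/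
structure IsPartialHom {T : ℝ} {n : ℕ} (X : TreeAlgLE L n →ₗ[ℝ] Fun2 T) : Prop where
  map_one : X ⟨Forest.mon 0, Forest.mon_mem (Nat.zero_le n)⟩ = 1
  map_mul : ∀ (σ ρ : Forest L) (h : (σ + ρ).size ≤ n) (hσ : σ.size ≤ n) (hρ : ρ.size ≤ n),
    X ⟨Forest.mon (σ + ρ), Forest.mon_mem h⟩
      = X ⟨Forest.mon σ, Forest.mon_mem hσ⟩ * X ⟨Forest.mon ρ, Forest.mon_mem hρ⟩
  mem_incr : ∀ (τ : LTree L) (h : τ.size ≤ n),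
    X ⟨MvPolynomial.X τ, LTree.X_mem h⟩ ∈ Incr2 T
  delta : ∀ x : TreeAlgLE L n, ∃ w : TreeAlgLE L n ⊗[ℝ] TreeAlgLE L n,
    TensorProduct.map (TreeAlgLE L n).subtype (TreeAlgLE L n).subtype w
        = reducedCoproduct (x : TreeAlg L) ∧
      ∀ t u s : Set.Icc (0 : ℝ) T, coboundary (X x) t u s = extProd X t u s w

end Branched

/-!
# Extension of partial homomorphisms to branched rough paths

For fixed `t` and `s` a homomorphism `Y` gives a character `Y_{ts}` of the tree algebra, and
`δ Y^x = Y^{Δ' x}` for all `x` says that `Y_{ts}` is the convolution of `Y_{tu}` and `Y_{us}`.  Both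
sides of this identity are characters, so it need only be checked on trees
(`delta_of_isChen`), and `Y` may be built by choosing its values on trees, one degree at a time.

Suppose the values on trees of size at most `m` are known, with `γ (m + 1) > 1`, and let `τ` have
size `m + 1`.  The reduced coproduct of `τ` involves smaller trees only, so the function
`h_{tus} = Y^{Δ' τ}_{tus}` is known.  Coassociativity of `Δ` (`coproduct_coassoc`, a consequence of
the recursion for `Δ`) makes convolution associative, and hence `h` a cocycle (`IsChen.cocycle`).
As `h` has exponent `γ |τ| > 1`, the sewing lemma (`exists_coboundary_eq`) writes it as `δ g` with
`g` of the same exponent.  The factor `1 / (2 ^ (γ |τ|) - 2)` in the sewing lemma is the one in the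
recursion for `q_γ`, and `B² ≤ B`, so the bounds persist with the same `A` and `B`
(`exists_extension_succ`).  Uniqueness (`eq_of_isChen`) holds because an additive increment of
exponent greater than `1` vanishes; it also makes the extensions to different degrees compatible.

In the sewing lemma, `h` is the coboundary of `f_{ts} = -h_{tso}` for a base point `o`.  No
regularity of `f` is available.  On a finite set of times one subtracts from `f` the increments of a
function of one variable so that the difference vanishes between neighbouring points; splitting at
the midpoint bounds it uniformly in the finite set (`abs_le_of_eq_zero_of_neighbours`).  A limit
along an ultrafilter of finite sets gives `g`, and repeated bisection improves its constant to the
sharp one (`abs_le_of_coboundary_midpoint`).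
-/

open scoped TensorProduct ENNReal

namespace Branched

universe u

variable {L : Type u} {T : ℝ}

open Filter Topology
open Algebra.TensorProduct (productMap)

/-! ### The sewing lemma -/

theorem two_lt_two_rpow {z : ℝ} (hz : 1 < z) : (2 : ℝ) < 2 ^ z := by
  simpa using Real.rpow_lt_rpow_of_exponent_lt (x := 2) (by norm_num) hz

theorem exists_midpoint (t s : Set.Icc (0 : ℝ) T) : ∃ u : Set.Icc (0 : ℝ) T,
    |(t : ℝ) - u| = |(t : ℝ) - s| / 2 ∧ |(u : ℝ) - s| = |(t : ℝ) - s| / 2 := by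
  have ht := t.2
  have hs := s.2
  refine ⟨⟨((t : ℝ) + s) / 2, by constructor <;> linarith [ht.1, ht.2, hs.1, hs.2]⟩, ?_, ?_⟩
  · rw [show (t : ℝ) - ((t : ℝ) + s) / 2 = (t - s) / 2 by ring, abs_div, abs_two]
  · rw [show ((t : ℝ) + s) / 2 - s = (t - s) / 2 by ring, abs_div, abs_two]

/-- An increment whose exponent exceeds `1` is controlled by its coboundary at midpoints, with the
constant `1 / (2 ^ z - 2)`; the a priori constant `K` is irrelevant. -/
theorem abs_le_of_coboundary_midpoint {z c K : ℝ} (hz : 1 < z) {g : Fun2 T}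
    (hK : ∀ t s, |g t s| ≤ K * |(t : ℝ) - s| ^ z)
    (hc : ∀ t u s : Set.Icc (0 : ℝ) T, |(t : ℝ) - u| = |(t : ℝ) - s| / 2 →
      |(u : ℝ) - s| = |(t : ℝ) - s| / 2 →
      |coboundary g t u s| ≤ c * (|(t : ℝ) - s| / 2) ^ z) (t s : Set.Icc (0 : ℝ) T) :
    |g t s| ≤ c / (2 ^ z - 2) * |(t : ℝ) - s| ^ z := by
  have h2 := two_lt_two_rpow hz
  have h0 : (0 : ℝ) < 2 ^ z := by linarith
  have h3 : (2 : ℝ) ^ z - 2 ≠ 0 := by linarith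
  set C := c / ((2 : ℝ) ^ z - 2) with hC
  -- Each bisection replaces the constant `C + x` by `C + 2 * 2 ^ (-z) * x`.
  have key : ∀ (k : ℕ) (t s : Set.Icc (0 : ℝ) T),
      |g t s| ≤ (C + (2 / 2 ^ z) ^ k * (K - C)) * |(t : ℝ) - s| ^ z := by
    intro k
    induction k with
    | zero => intro t s; simpa using hK t s
    | succ k ih =>
      intro t s
      obtain ⟨u, hu1, hu2⟩ := exists_midpoint t s
      have e1 := ih t u
      have e2 := ih u s
      have e3 := hc t u s hu1 hu2
      rw [hu1] at e1
      rw [hu2] at e2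
      rw [Real.div_rpow (abs_nonneg _) zero_le_two] at e1 e2 e3
      have e4 : |g t s| ≤ |coboundary g t u s| + |g t u| + |g u s| := by
        have : g t s = coboundary g t u s + g t u + g u s := by
          simp only [coboundary]; ring
        rw [this]
        exact abs_add_three _ _ _
      refine (e4.trans (add_le_add (add_le_add e3 e1) e2)).trans (le_of_eq ?_)
      have hcC : c = C * ((2 : ℝ) ^ z - 2) := by rw [hC]; field_simp
      rw [hcC, pow_succ]
      field_simp
      ring
  have hlim : Tendsto (fun k : ℕ => (C + (2 / 2 ^ z) ^ k * (K - C)) * |(t : ℝ) - s| ^ z) atTop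
      (𝓝 ((C + 0 * (K - C)) * |(t : ℝ) - s| ^ z)) := by
    refine (((tendsto_pow_atTop_nhds_zero_of_lt_one (by positivity) ?_).mul_const _).const_add
      _).mul_const _
    rwa [div_lt_one h0]
  rw [zero_mul, add_zero] at hlim
  exact ge_of_tendsto' hlim fun k => key k t s

/-- A function of one variable on a finite set whose increments between neighbouring points are
prescribed. -/
theorem exists_increments_eq {α : Type*} [LinearOrder α] (f : α → α → ℝ) (S : Finset α) :
    ∃ F : α → ℝ, ∀ s ∈ S, ∀ t ∈ S, s < t → (∀ u ∈ S, u ≤ s ∨ t ≤ u) → F t - F s = f t s := by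
  induction S using Finset.induction_on_max with
  | empty => exact ⟨0, by simp⟩
  | insert a S ha ih =>
    obtain ⟨F, hF⟩ := ih
    rcases S.eq_empty_or_nonempty with rfl | hS
    · exact ⟨0, by simp +contextual⟩
    refine ⟨Function.update F a (F (S.max' hS) + f a (S.max' hS)), ?_⟩
    intro s hs t ht hst hcons
    have hsa : s ≠ a := by
      rintro rfl
      rcases Finset.mem_insert.1 ht with rfl | ht
      · exact lt_irrefl _ hst
      · exact lt_asymm hst (ha t ht)
    have hsS := Finset.mem_of_mem_insert_of_ne hs hsa
    rw [Function.update_of_ne hsa]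
    rcases Finset.mem_insert.1 ht with rfl | htS
    · have : s = S.max' hS := by
        rcases hcons _ (Finset.mem_insert_of_mem (S.max'_mem hS)) with h | h
        · exact le_antisymm (S.le_max' s hsS) h
        · exact absurd (ha _ (S.max'_mem hS)) (not_lt.2 h)
      rw [Function.update_self, ← this]
      ring
    · rw [Function.update_of_ne (ha t htS).ne]
      exact hF s hsS t htS hst fun u hu => hcons u (Finset.mem_insert_of_mem hu)

/-- The maximal inequality behind sewing: on a finite set, an increment vanishing between
neighbouring points is bounded by its coboundary, uniformly in the set. -/
theorem abs_le_of_eq_zero_of_neighbours {z C K : ℝ} (hz : 1 < z)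
    (hK : 2 * C + 2 / 2 ^ z * K ≤ K) {G : Fun2 T}
    (hC : ∀ (t u s : Set.Icc (0 : ℝ) T) (d : ℝ), |(t : ℝ) - u| ≤ d → |(u : ℝ) - s| ≤ d →
      |coboundary G t u s| ≤ C * d ^ z)
    {S : Finset (Set.Icc (0 : ℝ) T)}
    (hG : ∀ s ∈ S, ∀ t ∈ S, s < t → (∀ u ∈ S, u ≤ s ∨ t ≤ u) → G t s = 0)
    (s : Set.Icc (0 : ℝ) T) (hs : s ∈ S) (t : Set.Icc (0 : ℝ) T) (ht : t ∈ S) (hst : s ≤ t) :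
    |G t s| ≤ K * |(t : ℝ) - s| ^ z := by
  have hz0 : z ≠ 0 := by linarith
  have hC0 : 0 ≤ C := by simpa using (abs_nonneg _).trans (hC s s s 1 (by simp) (by simp))
  have hK0 : 0 ≤ K := by
    have h1 : 2 / (2 : ℝ) ^ z < 1 := by
      rw [div_lt_one (by positivity)]; exact two_lt_two_rpow hz
    nlinarith
  induction hk : (S.filter fun u => s ≤ u ∧ u ≤ t).card using Nat.strong_induction_on
    generalizing s t with
  | _ k ih =>
  rcases hst.eq_or_lt with rfl | hlt
  · have := hC s s s 0 (by simp) (by simp)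
    have h0 : |G s s| ≤ 0 := by simpa [coboundary, Real.zero_rpow hz0] using this
    simpa [Real.zero_rpow hz0] using h0
  have hlt' : (s : ℝ) < t := hlt
  -- `i < j` are the neighbouring points of `S` around the midpoint of `s` and `t`.
  set m : ℝ := ((t : ℝ) + s) / 2 with hm
  have hne1 : (S.filter fun u => s ≤ u ∧ (u : ℝ) ≤ m).Nonempty :=
    ⟨s, Finset.mem_filter.2 ⟨hs, le_rfl, by rw [hm]; linarith⟩⟩
  have hne2 : (S.filter fun u : Set.Icc (0 : ℝ) T => m < (u : ℝ) ∧ u ≤ t).Nonempty :=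
    ⟨t, Finset.mem_filter.2 ⟨ht, by rw [hm]; linarith, le_rfl⟩⟩
  obtain ⟨i, hi, himax⟩ := Finset.exists_max_image _ id hne1
  obtain ⟨j, hj, hjmin⟩ := Finset.exists_min_image _ id hne2
  obtain ⟨hiS, hsi, him⟩ := Finset.mem_filter.1 hi
  obtain ⟨hjS, hmj, hjt⟩ := Finset.mem_filter.1 hj
  have hsi' : (s : ℝ) ≤ i := hsi
  have hjt' : (j : ℝ) ≤ t := hjt
  have hij' : (i : ℝ) < j := him.trans_lt hmj
  have hij : i < j := hij'
  have hGij : G j i = 0 := by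
    refine hG i hiS j hjS hij fun u hu => ?_
    by_contra! hcon
    rcases le_or_gt (u : ℝ) m with h | h
    · exact (himax u (Finset.mem_filter.2 ⟨hu, hsi.trans hcon.1.le, h⟩)).not_gt hcon.1
    · exact (hjmin u (Finset.mem_filter.2 ⟨hu, h, hcon.2.le.trans hjt⟩)).not_gt hcon.2
  have b1 : |G i s| ≤ K * |(i : ℝ) - s| ^ z := by
    refine ih _ ?_ s hs i hiS hsi rfl
    rw [← hk]
    refine Finset.card_lt_card ⟨fun u hu => ?_, fun hsub => ?_⟩
    · rw [Finset.mem_filter] at hu ⊢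
      exact ⟨hu.1, hu.2.1, hu.2.2.trans (hij.le.trans hjt)⟩
    · have := (Finset.mem_filter.1 (hsub (Finset.mem_filter.2 ⟨ht, hst, le_rfl⟩))).2.2
      exact (this.trans_lt (hij.trans_le hjt)).false
  have b2 : |G t j| ≤ K * |(t : ℝ) - j| ^ z := by
    refine ih _ ?_ j hjS t ht hjt rfl
    rw [← hk]
    refine Finset.card_lt_card ⟨fun u hu => ?_, fun hsub => ?_⟩
    · rw [Finset.mem_filter] at hu ⊢
      exact ⟨hu.1, (hsi.trans hij.le).trans hu.2.1, hu.2.2⟩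
    · have := (Finset.mem_filter.1 (hsub (Finset.mem_filter.2 ⟨hs, le_rfl, hst⟩))).2.1
      exact ((hsi.trans_lt hij).trans_le this).false
  have hw : 0 < (t : ℝ) - s := by linarith
  have hz' : 0 ≤ z := by linarith
  have b1' : |(i : ℝ) - s| ^ z ≤ (((t : ℝ) - s) / 2) ^ z := by
    refine Real.rpow_le_rpow (abs_nonneg _) ?_ hz'
    rw [abs_of_nonneg (by linarith)]
    linarith
  have b2' : |(t : ℝ) - j| ^ z ≤ (((t : ℝ) - s) / 2) ^ z := by
    refine Real.rpow_le_rpow (abs_nonneg _) ?_ hz'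
    rw [abs_of_nonneg (by linarith)]
    linarith
  have c1 := hC t j s ((t : ℝ) - s) (by rw [abs_of_nonneg] <;> linarith)
    (by rw [abs_of_nonneg] <;> linarith)
  have c2 := hC j i s ((t : ℝ) - s) (by rw [abs_of_nonneg] <;> linarith)
    (by rw [abs_of_nonneg] <;> linarith)
  have hdec : G t s = coboundary G t j s + coboundary G j i s + G t j + G i s := by
    simp only [coboundary, hGij]; ring
  have b3 := mul_le_mul_of_nonneg_left b1' hK0
  have b4 := mul_le_mul_of_nonneg_left b2' hK0
  rw [Real.div_rpow hw.le zero_le_two] at b3 b4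
  have hsum : |G t s| ≤ C * ((t : ℝ) - s) ^ z + C * ((t : ℝ) - s) ^ z
      + K * (((t : ℝ) - s) ^ z / 2 ^ z) + K * (((t : ℝ) - s) ^ z / 2 ^ z) := by
    rw [hdec]
    refine (abs_add_le _ _).trans (add_le_add ((abs_add_three _ _ _).trans ?_) (b1.trans b3))
    exact add_le_add (add_le_add c1 c2) (b2.trans b4)
  rw [abs_of_pos hw]
  refine hsum.trans (le_trans (le_of_eq ?_)
    (mul_le_mul_of_nonneg_right hK (Real.rpow_nonneg hw.le z)))
  ring

/-- The sewing lemma: a `2`-cocycle `h` of exponent `z > 1` is the coboundary of an increment of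
the same exponent, with the constant `1 / (2 ^ z - 2)`. -/
theorem exists_coboundary_eq {z C : ℝ} (hz : 1 < z)
    {h : Set.Icc (0 : ℝ) T → Set.Icc (0 : ℝ) T → Set.Icc (0 : ℝ) T → ℝ}
    (hcoc : ∀ t u v s, h t u v + h t v s = h u v s + h t u s)
    (hC : ∀ (t u s : Set.Icc (0 : ℝ) T) (d : ℝ), |(t : ℝ) - u| ≤ d → |(u : ℝ) - s| ≤ d →
      |h t u s| ≤ C * d ^ z) :
    ∃ g : Fun2 T, (∀ t u s, coboundary g t u s = h t u s) ∧
      ∀ t s, |g t s| ≤ C / (2 ^ z - 2) * |(t : ℝ) - s| ^ z := by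
  rcases isEmpty_or_nonempty (Set.Icc (0 : ℝ) T) with hempty | ⟨⟨o⟩⟩
  · exact ⟨0, fun t => (hempty.false t).elim, fun t => (hempty.false t).elim⟩
  have h2 := two_lt_two_rpow hz
  have hz0 : z ≠ 0 := by linarith
  set K : ℝ := 2 * C / (1 - 2 / 2 ^ z) with hKdef
  have hK : 2 * C + 2 / 2 ^ z * K ≤ K := by
    have : (1 : ℝ) - 2 / 2 ^ z ≠ 0 := by
      have : 2 / (2 : ℝ) ^ z < 1 := by rwa [div_lt_one (by positivity)]
      linarith
    have : K * (1 - 2 / 2 ^ z) = 2 * C := div_mul_cancel₀ _ this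
    linarith
  -- The cocycle `h` is the coboundary of `f`; subtracting increments of functions of one
  -- variable gives, for each finite set, a primitive that is small on this set.
  have step : ∀ S : Finset (Set.Icc (0 : ℝ) T), ∃ G : Fun2 T,
      (∀ t u s, coboundary G t u s = h t u s) ∧
      ∀ s ∈ S, ∀ t ∈ S, |G t s| ≤ (K + C) * |(t : ℝ) - s| ^ z := by
    intro S
    set f : Fun2 T := fun t s => -h t s o with hf
    obtain ⟨F, hF⟩ := exists_increments_eq f S
    have hcob : ∀ t u s, coboundary (fun t s => f t s - (F t - F s) : Fun2 T) t u s = h t u s := by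
      intro t u s
      have := hcoc t u s o
      simp only [coboundary, hf]
      linarith
    refine ⟨fun t s => f t s - (F t - F s), hcob, ?_⟩
    have main := abs_le_of_eq_zero_of_neighbours hz hK
      (G := fun t s => f t s - (F t - F s)) (S := S)
      (fun t u s d h1 h2 => by rw [hcob]; exact hC t u s d h1 h2)
      (fun s hs t ht hst hu => by simp only [hF s hs t ht hst hu, sub_self])
    have hC0 : 0 ≤ C := by simpa using (abs_nonneg _).trans (hC o o o 1 (by simp) (by simp))
    intro s hs t ht
    have hp : 0 ≤ |(t : ℝ) - s| ^ z := Real.rpow_nonneg (abs_nonneg _) z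
    rcases le_total s t with hst | hst
    · have := main s hs t ht hst
      nlinarith
    · have h1 := main t ht s hs hst
      have h3 := hC s t s |(t : ℝ) - s| (by rw [abs_sub_comm]) le_rfl
      have h4 := hcob s t s
      have h5 := hcob s s s
      have h6 : h s s s = 0 := by
        have := hC s s s 0 (by simp) (by simp)
        rw [Real.zero_rpow hz0, mul_zero] at this
        exact abs_nonpos_iff.1 this
      rw [abs_sub_comm (s : ℝ) t] at h1
      simp only [coboundary] at h4 h5
      have h7 : f t s - (F t - F s) = -(f s t - (F s - F t)) + -h s t s := by linarith
      change |f t s - (F t - F s)| ≤ _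
      rw [h7]
      refine (abs_add_le _ _).trans ?_
      rw [abs_neg, abs_neg, add_mul]
      exact add_le_add h1 h3
  choose G hGcob hGle using step
  let U : Ultrafilter (Finset (Set.Icc (0 : ℝ) T)) := Ultrafilter.of atTop
  have hU : (U : Filter (Finset (Set.Icc (0 : ℝ) T))) ≤ atTop := Ultrafilter.of_le _
  have hev : ∀ t s, ∀ᶠ S in (U : Filter (Finset (Set.Icc (0 : ℝ) T))),
      |G S t s| ≤ (K + C) * |(t : ℝ) - s| ^ z := by
    intro t s
    filter_upwards [hU (eventually_ge_atTop {t, s})] with S hS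
    exact hGle S s (hS (by simp)) t (hS (by simp))
  have hlim : ∀ t s, ∃ x : ℝ, Tendsto (fun S => G S t s) U (𝓝 x) := by
    intro t s
    obtain ⟨x, -, hx⟩ := (isCompact_Icc (a := -((K + C) * |(t : ℝ) - s| ^ z))
      (b := (K + C) * |(t : ℝ) - s| ^ z)).ultrafilter_le_nhds (U.map fun S => G S t s) (by
        rw [le_principal_iff]
        exact (hev t s).mono fun S hS => abs_le.1 hS)
    exact ⟨x, hx⟩
  choose g hg using hlim
  have hgcob : ∀ t u s, coboundary g t u s = h t u s := fun t u s =>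
    tendsto_nhds_unique (((hg t s).sub (hg t u)).sub (hg u s))
      (tendsto_const_nhds.congr fun S => (hGcob S t u s).symm)
  refine ⟨g, hgcob, abs_le_of_coboundary_midpoint hz
    (fun t s => le_of_tendsto (hg t s).abs (hev t s)) ?_⟩
  intro t u s h1 h3
  rw [hgcob]
  exact hC t u s _ h1.le h3.le

/-! ### Coassociativity and convolution of characters -/

theorem exists_eq_graft (τ : LTree L) : ∃ (a : L) (σ : Forest L), τ = graft a σ := by
  induction τ using Quot.ind with
  | mk t =>
    obtain ⟨a, l⟩ := t
    exact ⟨a, _, (graft_map_mk a l).symm⟩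

@[simp]
theorem Forest.mon_zero : Forest.mon (0 : Forest L) = 1 := by simp [Forest.mon]

@[simp]
theorem Forest.mon_cons (τ : LTree L) (σ : Forest L) :
    Forest.mon (τ ::ₘ σ) = MvPolynomial.X τ * Forest.mon σ := by simp [Forest.mon]

theorem Forest.size_cons (τ : LTree L) (σ : Forest L) :
    Forest.size (τ ::ₘ σ) = τ.size + σ.size := by simp [Forest.size]

theorem linearMap_ext_mon {M : Type*} [AddCommMonoid M] [Module ℝ M]
    {f g : TreeAlg L →ₗ[ℝ] M} (h : ∀ σ : Forest L, f σ.mon = g σ.mon) : f = g := by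
  classical
  refine (MvPolynomial.basisMonomials (LTree L) ℝ).ext fun m => ?_
  have := h (Finsupp.toMultiset m)
  rw [Forest.mon_eq_monomial] at this
  rw [MvPolynomial.coe_basisMonomials]
  convert this using 3 <;> simp

theorem coproduct_bPlus (a : L) (x : TreeAlg L) : coproduct (bPlus a x)
    = 1 ⊗ₜ[ℝ] bPlus a x + (bPlus a).rTensor (TreeAlg L) (coproduct x) := by
  have : coproduct.toLinearMap ∘ₗ bPlus a = TensorProduct.mk ℝ _ _ 1 ∘ₗ bPlus a
      + (bPlus a).rTensor (TreeAlg L) ∘ₗ (coproduct (L := L)).toLinearMap := by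
    refine linearMap_ext_mon fun σ => ?_
    simp [bPlus_mon, coproduct_graft]
  exact LinearMap.congr_fun this x

/-- The coproduct is coassociative: by induction on the size of a tree, from the recursion
`Δ B₊ᵃ = 1 ⊗ B₊ᵃ + (B₊ᵃ ⊗ id) Δ`. -/
theorem coproduct_coassoc :
    ((Algebra.TensorProduct.assoc ℝ ℝ ℝ (TreeAlg L) (TreeAlg L) (TreeAlg L)).toAlgHom.comp
        (Algebra.TensorProduct.map coproduct (AlgHom.id ℝ (TreeAlg L)))).comp coproduct
      = (Algebra.TensorProduct.map (AlgHom.id ℝ (TreeAlg L)) coproduct).comp coproduct := by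
  refine MvPolynomial.algHom_ext fun τ => ?_
  induction hk : τ.size using Nat.strong_induction_on generalizing τ with
  | _ k ih =>
  obtain ⟨a, σ, rfl⟩ := exists_eq_graft τ
  rw [graft_size] at hk
  have hσ : ∀ ρ : Forest L, ρ.size < k →
      ((Algebra.TensorProduct.assoc ℝ ℝ ℝ (TreeAlg L) (TreeAlg L) (TreeAlg L)).toAlgHom.comp
        (Algebra.TensorProduct.map coproduct (AlgHom.id ℝ (TreeAlg L)))).comp coproduct ρ.mon
      = (Algebra.TensorProduct.map (AlgHom.id ℝ (TreeAlg L)) coproduct).comp coproduct ρ.mon := by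
    intro ρ
    induction ρ using Multiset.induction with
    | empty => intro _; rw [Forest.mon_zero, map_one, map_one]
    | cons τ ρ ihρ =>
      intro hlt
      rw [Forest.size_cons] at hlt
      rw [Forest.mon_cons, map_mul, map_mul, ihρ (by omega), ih _ (by omega) τ rfl]
  have e := hσ σ (by omega)
  -- `B₊ᵃ` acts on the leftmost factor and commutes with reassociation and with `Δ` on the right;
  -- past `Δ` on the left it leaves the extra term `1 ⊗ _`.
  have l1 : ∀ (w : TreeAlg L ⊗[ℝ] TreeAlg L) (y : TreeAlg L),
      Algebra.TensorProduct.assoc ℝ ℝ ℝ (TreeAlg L) (TreeAlg L) (TreeAlg L)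
        ((bPlus a).rTensor (TreeAlg L) w ⊗ₜ[ℝ] y)
      = (bPlus a).rTensor (TreeAlg L ⊗[ℝ] TreeAlg L)
        (Algebra.TensorProduct.assoc ℝ ℝ ℝ (TreeAlg L) (TreeAlg L) (TreeAlg L) (w ⊗ₜ[ℝ] y)) := by
    intro w y
    induction w with
    | zero => simp
    | add w₁ w₂ h₁ h₂ => simp only [map_add, TensorProduct.add_tmul, h₁, h₂]
    | tmul w₁ w₂ => simp
  have l2 : ∀ w : TreeAlg L ⊗[ℝ] TreeAlg L,
      Algebra.TensorProduct.assoc ℝ ℝ ℝ (TreeAlg L) (TreeAlg L) (TreeAlg L)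
        (Algebra.TensorProduct.map coproduct (AlgHom.id ℝ (TreeAlg L))
          ((bPlus a).rTensor (TreeAlg L) w))
      = 1 ⊗ₜ[ℝ] (bPlus a).rTensor (TreeAlg L) w + (bPlus a).rTensor (TreeAlg L ⊗[ℝ] TreeAlg L)
        (Algebra.TensorProduct.assoc ℝ ℝ ℝ (TreeAlg L) (TreeAlg L) (TreeAlg L)
          (Algebra.TensorProduct.map coproduct (AlgHom.id ℝ (TreeAlg L)) w)) := by
    intro w
    induction w with
    | zero => simp
    | add w₁ w₂ h₁ h₂ =>
      simp only [map_add, TensorProduct.tmul_add, h₁, h₂]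
      abel
    | tmul w₁ w₂ =>
      simp only [LinearMap.rTensor_tmul, Algebra.TensorProduct.map_tmul, AlgHom.coe_id, id_eq,
        coproduct_bPlus, TensorProduct.add_tmul, map_add, l1,
        Algebra.TensorProduct.assoc_tmul]
  have l3 : ∀ w : TreeAlg L ⊗[ℝ] TreeAlg L,
      Algebra.TensorProduct.map (AlgHom.id ℝ (TreeAlg L)) coproduct
          ((bPlus a).rTensor (TreeAlg L) w)
      = (bPlus a).rTensor (TreeAlg L ⊗[ℝ] TreeAlg L)
          (Algebra.TensorProduct.map (AlgHom.id ℝ (TreeAlg L)) coproduct w) := by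
    intro w
    induction w with
    | zero => simp
    | add w₁ w₂ h₁ h₂ => simp only [map_add, h₁, h₂]
    | tmul w₁ w₂ => simp
  change Algebra.TensorProduct.assoc ℝ ℝ ℝ (TreeAlg L) (TreeAlg L) (TreeAlg L)
      (Algebra.TensorProduct.map coproduct (AlgHom.id ℝ (TreeAlg L)) (coproduct σ.mon))
    = Algebra.TensorProduct.map (AlgHom.id ℝ (TreeAlg L)) coproduct (coproduct σ.mon) at e
  change Algebra.TensorProduct.assoc ℝ ℝ ℝ (TreeAlg L) (TreeAlg L) (TreeAlg L)
      (Algebra.TensorProduct.map coproduct (AlgHom.id ℝ (TreeAlg L)) (coproduct _))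
    = Algebra.TensorProduct.map (AlgHom.id ℝ (TreeAlg L)) coproduct (coproduct _)
  rw [coproduct_graft]
  simp only [map_add, l2, l3, e, Algebra.TensorProduct.map_tmul, map_one, AlgHom.coe_id, id_eq,
    coproduct_graft, Algebra.TensorProduct.one_def, Algebra.TensorProduct.assoc_tmul,
    TensorProduct.tmul_add,
    add_assoc]

/-- The convolution `(φ ⊗ ψ) ∘ Δ` of two characters of the tree algebra. -/
noncomputable def conv (φ ψ : TreeAlg L →ₐ[ℝ] ℝ) : TreeAlg L →ₐ[ℝ] ℝ :=
  (productMap φ ψ).comp coproduct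

theorem conv_assoc (φ ψ χ : TreeAlg L →ₐ[ℝ] ℝ) :
    conv (conv φ ψ) χ = conv φ (conv ψ χ) := by
  have h1 : productMap (conv φ ψ) χ = ((productMap φ (productMap ψ χ)).comp
      (Algebra.TensorProduct.assoc ℝ ℝ ℝ (TreeAlg L) (TreeAlg L) (TreeAlg L)).toAlgHom).comp
        (Algebra.TensorProduct.map coproduct (AlgHom.id ℝ (TreeAlg L))) := by
    have h0 : productMap (productMap φ ψ) χ = (productMap φ (productMap ψ χ)).comp
        (Algebra.TensorProduct.assoc ℝ ℝ ℝ (TreeAlg L) (TreeAlg L) (TreeAlg L)).toAlgHom := by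
      ext <;> simp [Algebra.TensorProduct.one_def]
    rw [← h0]
    refine Algebra.TensorProduct.ext' fun x y => ?_
    simp [conv]
  have h2 : productMap φ (conv ψ χ) = (productMap φ (productMap ψ χ)).comp
        (Algebra.TensorProduct.map (AlgHom.id ℝ (TreeAlg L)) coproduct) := by
    refine Algebra.TensorProduct.ext' fun x y => ?_
    simp [conv]
  conv_lhs => rw [conv, h1]
  conv_rhs => rw [conv, h2]
  rw [AlgHom.comp_assoc, AlgHom.comp_assoc, ← AlgHom.comp_assoc _ _ coproduct, coproduct_coassoc,
    AlgHom.comp_assoc]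

/-- The value of `φ ⊗ ψ` on the reduced coproduct of a tree. -/
noncomputable def reducedSum (φ ψ : TreeAlg L →ₐ[ℝ] ℝ) (τ : LTree L) : ℝ :=
  (τ.reducedTerms.map fun p => φ p.1.mon * ψ p.2.mon).sum

theorem productMap_reducedCoproduct (φ ψ : TreeAlg L →ₐ[ℝ] ℝ) (x : TreeAlg L) :
    productMap φ ψ (reducedCoproduct x) = conv φ ψ x - φ x - ψ x := by
  simp [reducedCoproduct, conv]
  ring

theorem productMap_reducedCoproduct_X (φ ψ : TreeAlg L →ₐ[ℝ] ℝ) (τ : LTree L) :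
    productMap φ ψ (reducedCoproduct (MvPolynomial.X τ)) = reducedSum φ ψ τ := by
  rw [reducedCoproduct_X, map_multiset_sum, Multiset.map_map]
  rfl

theorem conv_X (φ ψ : TreeAlg L →ₐ[ℝ] ℝ) (τ : LTree L) : conv φ ψ (MvPolynomial.X τ)
    = φ (MvPolynomial.X τ) + ψ (MvPolynomial.X τ) + reducedSum φ ψ τ := by
  rw [← productMap_reducedCoproduct_X, productMap_reducedCoproduct]
  ring

theorem map_mon_congr {R : Type*} [CommSemiring R] [Algebra ℝ R] {φ φ' : TreeAlg L →ₐ[ℝ] R}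
    {m : ℕ} (h : ∀ τ : LTree L, τ.size ≤ m → φ (MvPolynomial.X τ) = φ' (MvPolynomial.X τ))
    {σ : Forest L} (hσ : σ.size ≤ m) : φ σ.mon = φ' σ.mon := by
  simp only [Forest.mon, map_multiset_prod, Multiset.map_map]
  congr 1
  exact Multiset.map_congr rfl fun τ hτ => h τ ((LTree.size_le_of_mem hτ).trans hσ)

/-- The sum over the reduced coproduct of `τ` involves only trees smaller than `τ`. -/
theorem reducedSum_congr {φ φ' ψ ψ' : TreeAlg L →ₐ[ℝ] ℝ} {τ : LTree L}
    (hφ : ∀ ρ : LTree L, ρ.size < τ.size → φ (MvPolynomial.X ρ) = φ' (MvPolynomial.X ρ))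
    (hψ : ∀ ρ : LTree L, ρ.size < τ.size → ψ (MvPolynomial.X ρ) = ψ' (MvPolynomial.X ρ)) :
    reducedSum φ ψ τ = reducedSum φ' ψ' τ := by
  have hpos := τ.size_pos
  refine congrArg Multiset.sum (Multiset.map_congr rfl fun p hp => ?_)
  obtain ⟨h1, h2⟩ := LTree.reducedTerms_size_lt hp
  rw [map_mon_congr (m := τ.size - 1) (fun ρ hρ => hφ ρ (by omega)) (by omega),
    map_mon_congr (m := τ.size - 1) (fun ρ hρ => hψ ρ (by omega)) (by omega)]

/-! ### Chen's relation -/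

/-- The character `x ↦ Y^x_{ts}`. -/
noncomputable def charAt (Y : TreeAlg L →ₐ[ℝ] Fun2 T) (t s : Set.Icc (0 : ℝ) T) :
    TreeAlg L →ₐ[ℝ] ℝ :=
  ((Pi.evalAlgHom ℝ (fun _ : Set.Icc (0 : ℝ) T => ℝ) s).comp
    (Pi.evalAlgHom ℝ (fun _ : Set.Icc (0 : ℝ) T => Set.Icc (0 : ℝ) T → ℝ) t)).comp Y

@[simp]
theorem charAt_apply (Y : TreeAlg L →ₐ[ℝ] Fun2 T) (t s : Set.Icc (0 : ℝ) T) (x : TreeAlg L) :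
    charAt Y t s x = Y x t s := rfl

theorem extProd_toLinearMap (Y : TreeAlg L →ₐ[ℝ] Fun2 T) (t u s : Set.Icc (0 : ℝ) T)
    (w : TreeAlg L ⊗[ℝ] TreeAlg L) :
    extProd Y.toLinearMap t u s w = productMap (charAt Y t u) (charAt Y u s) w := by
  induction w with
  | zero => simp
  | add w₁ w₂ h₁ h₂ => rw [map_add, map_add, h₁, h₂]
  | tmul x y => rfl

theorem extProd_comp {V W : Type*} [AddCommGroup V] [Module ℝ V] [AddCommGroup W] [Module ℝ W]
    (f : W →ₗ[ℝ] Fun2 T) (g : V →ₗ[ℝ] W) (t u s : Set.Icc (0 : ℝ) T) (w : V ⊗[ℝ] V) :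
    extProd (f ∘ₗ g) t u s w = extProd f t u s (TensorProduct.map g g w) := by
  induction w with
  | zero => simp
  | add w₁ w₂ h₁ h₂ => rw [map_add, map_add, map_add, h₁, h₂]
  | tmul x y => rfl

/-- The relation `δ Y^τ = Y^{Δ' τ}` on the trees of size at most `m`. -/
def IsChen (m : ℕ) (Y : TreeAlg L →ₐ[ℝ] Fun2 T) : Prop :=
  ∀ τ : LTree L, τ.size ≤ m → ∀ t u s, coboundary (Y (MvPolynomial.X τ)) t u s
    = reducedSum (charAt Y t u) (charAt Y u s) τ

theorem IsChen.mono {m m' : ℕ} (h : m ≤ m') {Y : TreeAlg L →ₐ[ℝ] Fun2 T} (hY : IsChen m' Y) :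
    IsChen m Y := fun τ hτ => hY τ (hτ.trans h)

theorem isChen_of_delta {Y : TreeAlg L →ₐ[ℝ] Fun2 T}
    (h : ∀ (x : TreeAlg L) (t u s : Set.Icc (0 : ℝ) T),
      coboundary (Y x) t u s = extProd Y.toLinearMap t u s (reducedCoproduct x)) (m : ℕ) :
    IsChen m Y := fun τ _ t u s => by
  rw [h, extProd_toLinearMap, productMap_reducedCoproduct_X]

theorem IsChen.conv_X {m : ℕ} {Y : TreeAlg L →ₐ[ℝ] Fun2 T} (hY : IsChen m Y) {τ : LTree L}
    (hτ : τ.size ≤ m) (t u s : Set.Icc (0 : ℝ) T) :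
    conv (charAt Y t u) (charAt Y u s) (MvPolynomial.X τ) = charAt Y t s (MvPolynomial.X τ) := by
  rw [Branched.conv_X, ← hY τ hτ]
  simp [coboundary]

/-- Chen's relation on trees extends to the whole algebra, because both sides of
`Y_{tu} * Y_{us} = Y_{ts}` are characters. -/
theorem delta_of_isChen {Y : TreeAlg L →ₐ[ℝ] Fun2 T} (hY : ∀ m, IsChen m Y) (x : TreeAlg L)
    (t u s : Set.Icc (0 : ℝ) T) :
    coboundary (Y x) t u s = extProd Y.toLinearMap t u s (reducedCoproduct x) := by
  have : conv (charAt Y t u) (charAt Y u s) = charAt Y t s :=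
    MvPolynomial.algHom_ext fun τ => (hY τ.size).conv_X le_rfl t u s
  rw [extProd_toLinearMap, productMap_reducedCoproduct, this]
  rfl

/-- Given Chen's relation on smaller trees, the right-hand side of the relation for `τ` is a
cocycle, by associativity of the convolution. -/
theorem IsChen.cocycle {m : ℕ} {Y : TreeAlg L →ₐ[ℝ] Fun2 T} (hY : IsChen m Y) {τ : LTree L}
    (hτ : τ.size = m + 1) (t u v s : Set.Icc (0 : ℝ) T) :
    reducedSum (charAt Y t u) (charAt Y u v) τ + reducedSum (charAt Y t v) (charAt Y v s) τ
      = reducedSum (charAt Y u v) (charAt Y v s) τ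
        + reducedSum (charAt Y t u) (charAt Y u s) τ := by
  have h := DFunLike.congr_fun (conv_assoc (charAt Y t u) (charAt Y u v) (charAt Y v s))
    (MvPolynomial.X τ)
  have h1 : reducedSum (conv (charAt Y t u) (charAt Y u v)) (charAt Y v s) τ
      = reducedSum (charAt Y t v) (charAt Y v s) τ :=
    reducedSum_congr (fun ρ hρ => hY.conv_X (by omega) t u v) fun _ _ => rfl
  have h2 : reducedSum (charAt Y t u) (conv (charAt Y u v) (charAt Y v s)) τ
      = reducedSum (charAt Y t u) (charAt Y u s) τ :=
    reducedSum_congr (fun _ _ => rfl) fun ρ hρ => hY.conv_X (by omega) u v s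
  rw [Branched.conv_X, Branched.conv_X, Branched.conv_X (charAt Y t u), Branched.conv_X,
    h1, h2] at h
  linarith

/-! ### Weights and Hölder bounds -/

theorem two_lt_two_rpow_of_not_le {γ : ℝ} (hγ : 0 < γ) {τ : LTree L}
    (h : ¬ (τ.size : ℝ) ≤ 1 / γ) : (2 : ℝ) < 2 ^ (γ * τ.size) := by
  refine two_lt_two_rpow ?_
  rw [not_le, div_lt_iff₀ hγ] at h
  linarith

theorem qTree_nonneg {γ : ℝ} (hγ : 0 < γ) (τ : LTree L) : 0 ≤ qTree γ τ := by
  induction hk : τ.size using Nat.strong_induction_on generalizing τ with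
  | _ k ih =>
  by_cases h : (τ.size : ℝ) ≤ 1 / γ
  · rw [qTree_eq_one h]
    exact zero_le_one
  have hq : ∀ σ : Forest L, σ.size < k → 0 ≤ q γ σ := by
    intro σ hσ
    refine Multiset.prod_nonneg fun x hx => ?_
    obtain ⟨ρ, hρ, rfl⟩ := Multiset.mem_map.1 hx
    exact ih _ ((LTree.size_le_of_mem hρ).trans_lt hσ) ρ rfl
  rw [qTree_eq h]
  refine mul_nonneg (one_div_nonneg.2 (by linarith [two_lt_two_rpow_of_not_le hγ h]))
    (Multiset.sum_nonneg fun x hx => ?_)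
  obtain ⟨p, hp, rfl⟩ := Multiset.mem_map.1 hx
  obtain ⟨h1, h2⟩ := LTree.reducedTerms_size_lt hp
  exact mul_nonneg (hq _ (hk ▸ h1)) (hq _ (hk ▸ h2))

theorem q_nonneg {γ : ℝ} (hγ : 0 < γ) (σ : Forest L) : 0 ≤ q γ σ := by
  refine Multiset.prod_nonneg fun x hx => ?_
  obtain ⟨ρ, -, rfl⟩ := Multiset.mem_map.1 hx
  exact qTree_nonneg hγ ρ

theorem q_cons (γ : ℝ) (τ : LTree L) (σ : Forest L) : q γ (τ ::ₘ σ) = qTree γ τ * q γ σ := by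
  simp [q]

/-- Bounds on trees pass to nonempty forests; powers of `B ≤ 1` are absorbed into one factor. -/
theorem abs_mon_le {γ B θ : ℝ} (hγ : 0 < γ) (hB₀ : 0 ≤ B) (hB₁ : B ≤ 1) (hθ : 0 ≤ θ)
    {φ : TreeAlg L →ₐ[ℝ] ℝ} {m : ℕ}
    (h : ∀ τ : LTree L, τ.size ≤ m →
      |φ (MvPolynomial.X τ)| ≤ B * (θ ^ τ.size * qTree γ τ))
    {σ : Forest L} (hσ : σ ≠ 0) (hm : σ.size ≤ m) :
    |φ σ.mon| ≤ B * (θ ^ σ.size * q γ σ) := by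
  induction σ using Multiset.induction with
  | empty => exact absurd rfl hσ
  | cons τ σ ih =>
    rw [Forest.size_cons] at hm
    have h1 := h τ (by omega)
    rw [Forest.mon_cons, map_mul, abs_mul, Forest.size_cons, q_cons]
    have hx : 0 ≤ θ ^ τ.size * qTree γ τ := mul_nonneg (pow_nonneg hθ _) (qTree_nonneg hγ τ)
    rcases eq_or_ne σ 0 with rfl | h0
    · simpa [Forest.size, q] using h1
    have h2 := ih h0 (by omega)
    have hy : 0 ≤ θ ^ Forest.size σ * q γ σ := mul_nonneg (pow_nonneg hθ _) (q_nonneg hγ σ)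
    calc |φ (MvPolynomial.X τ)| * |φ (Forest.mon σ)|
        ≤ (B * (θ ^ τ.size * qTree γ τ)) * (B * (θ ^ Forest.size σ * q γ σ)) :=
          mul_le_mul h1 h2 (abs_nonneg _) (mul_nonneg hB₀ hx)
      _ = (B * B) * ((θ ^ τ.size * qTree γ τ) * (θ ^ Forest.size σ * q γ σ)) := by ring
      _ ≤ B * ((θ ^ τ.size * qTree γ τ) * (θ ^ Forest.size σ * q γ σ)) :=
          mul_le_mul_of_nonneg_right (mul_le_of_le_one_left hB₀ hB₁) (mul_nonneg hx hy)
      _ = B * (θ ^ (τ.size + Forest.size σ) * (qTree γ τ * q γ σ)) := by rw [pow_add]; ring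

theorem abs_multiset_sum_le {ι : Type*} (s : Multiset ι) {f g : ι → ℝ}
    (h : ∀ i ∈ s, |f i| ≤ g i) : |(s.map f).sum| ≤ (s.map g).sum := by
  induction s using Multiset.induction with
  | empty => simp
  | cons a s ih =>
    rw [Multiset.map_cons, Multiset.map_cons, Multiset.sum_cons, Multiset.sum_cons]
    exact (abs_add_le _ _).trans (add_le_add (h a (Multiset.mem_cons_self a s))
      (ih fun i hi => h i (Multiset.mem_cons_of_mem hi)))

theorem abs_reducedSum_le {γ B θ : ℝ} (hγ : 0 < γ) (hB₀ : 0 ≤ B) (hB₁ : B ≤ 1) (hθ : 0 ≤ θ)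
    {φ ψ : TreeAlg L →ₐ[ℝ] ℝ} {τ : LTree L}
    (hφ : ∀ ρ : LTree L, ρ.size < τ.size →
      |φ (MvPolynomial.X ρ)| ≤ B * (θ ^ ρ.size * qTree γ ρ))
    (hψ : ∀ ρ : LTree L, ρ.size < τ.size →
      |ψ (MvPolynomial.X ρ)| ≤ B * (θ ^ ρ.size * qTree γ ρ)) :
    |reducedSum φ ψ τ|
      ≤ B * (θ ^ τ.size * (τ.reducedTerms.map fun p => q γ p.1 * q γ p.2).sum) := by
  classical
  have hpos := τ.size_pos
  rw [← Multiset.sum_map_mul_left, ← Multiset.sum_map_mul_left]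
  refine abs_multiset_sum_le _ fun p hp => ?_
  obtain ⟨l1, l2⟩ := LTree.reducedTerms_size_lt hp
  rw [LTree.reducedTerms, Multiset.mem_filter] at hp
  have h1 := abs_mon_le hγ hB₀ hB₁ hθ (m := τ.size - 1) (fun ρ hρ => hφ ρ (by omega)) hp.2.1
    (by omega)
  have h2 := abs_mon_le hγ hB₀ hB₁ hθ (m := τ.size - 1) (fun ρ hρ => hψ ρ (by omega)) hp.2.2
    (by omega)
  have hx : 0 ≤ θ ^ p.1.size * q γ p.1 := mul_nonneg (pow_nonneg hθ _) (q_nonneg hγ _)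
  have hy : 0 ≤ θ ^ p.2.size * q γ p.2 := mul_nonneg (pow_nonneg hθ _) (q_nonneg hγ _)
  rw [abs_mul]
  calc |φ p.1.mon| * |ψ p.2.mon|
      ≤ (B * (θ ^ p.1.size * q γ p.1)) * (B * (θ ^ p.2.size * q γ p.2)) :=
        mul_le_mul h1 h2 (abs_nonneg _) (mul_nonneg hB₀ hx)
    _ = (B * B) * ((θ ^ p.1.size * q γ p.1) * (θ ^ p.2.size * q γ p.2)) := by ring
    _ ≤ B * ((θ ^ p.1.size * q γ p.1) * (θ ^ p.2.size * q γ p.2)) :=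
        mul_le_mul_of_nonneg_right (mul_le_of_le_one_left hB₀ hB₁) (mul_nonneg hx hy)
    _ = B * (θ ^ τ.size * (q γ p.1 * q γ p.2)) := by
        rw [← τ.terms_size p hp.1, pow_add]; ring

/-- Bounds `|Y^τ_{ts}| ≤ B A^{|τ|} q_γ(τ) |t - s|^{γ|τ|}` on the trees of size at most `m`, with
`A^{|τ|} |t - s|^{γ|τ|}` written as a single power. -/
def TreeBound (γ A B : ℝ) (m : ℕ) (Y : TreeAlg L →ₐ[ℝ] Fun2 T) : Prop :=
  ∀ τ : LTree L, τ.size ≤ m → ∀ t s : Set.Icc (0 : ℝ) T,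
    |Y (MvPolynomial.X τ) t s| ≤ B * ((A * |(t : ℝ) - s| ^ γ) ^ τ.size * qTree γ τ)

theorem TreeBound.mono {γ A B : ℝ} {m m' : ℕ} (h : m ≤ m') {Y : TreeAlg L →ₐ[ℝ] Fun2 T}
    (hY : TreeBound γ A B m' Y) : TreeBound γ A B m Y := fun τ hτ => hY τ (hτ.trans h)

theorem mul_rpow_pow (γ A B c : ℝ) {w : ℝ} (hw : 0 ≤ w) (k : ℕ) :
    B * ((A * w ^ γ) ^ k * c) = B * A ^ k * c * w ^ (γ * k) := by
  rw [mul_pow, Real.rpow_mul_natCast hw]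
  ring

theorem abs_le_of_holderNorm_le {μ c : ℝ} (hc : 0 ≤ c) {g : Fun2 T} (hg : g ∈ Incr2 T)
    (h : holderNorm μ g ≤ ENNReal.ofReal c) (t s : Set.Icc (0 : ℝ) T) :
    |g t s| ≤ c * |(t : ℝ) - s| ^ μ := by
  rcases eq_or_ne t s with rfl | hts
  · rw [hg t, abs_zero]
    exact mul_nonneg hc (Real.rpow_nonneg (abs_nonneg _) _)
  have hpos : 0 < |(t : ℝ) - s| ^ μ :=
    Real.rpow_pos_of_pos (abs_pos.2 (sub_ne_zero.2 (Subtype.coe_injective.ne hts))) _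
  have h1 := (le_iSup₂ (f := fun t s : Set.Icc (0 : ℝ) T =>
    ENNReal.ofReal (|g t s| / |(t : ℝ) - (s : ℝ)| ^ μ)) t s).trans h
  rwa [ENNReal.ofReal_le_ofReal_iff hc, div_le_iff₀ hpos] at h1

theorem holderNorm_le_of_abs_le {μ c : ℝ} (hc : 0 ≤ c) {g : Fun2 T}
    (h : ∀ t s : Set.Icc (0 : ℝ) T, |g t s| ≤ c * |(t : ℝ) - s| ^ μ) :
    holderNorm μ g ≤ ENNReal.ofReal c :=
  iSup₂_le fun t s => ENNReal.ofReal_le_ofReal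
    (div_le_of_le_mul₀ (Real.rpow_nonneg (abs_nonneg _) _) hc (h t s))

theorem TreeBound.mem_incr {γ A B : ℝ} (hγ : 0 < γ) {m : ℕ} {Y : TreeAlg L →ₐ[ℝ] Fun2 T}
    (hY : TreeBound γ A B m Y) {τ : LTree L} (hτ : τ.size ≤ m) :
    Y (MvPolynomial.X τ) ∈ Incr2 T := fun t => by
  have := hY τ hτ t t
  rw [sub_self, abs_zero, Real.zero_rpow hγ.ne', mul_zero, zero_pow τ.size_pos.ne', zero_mul,
    mul_zero] at this
  exact abs_nonpos_iff.1 this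

/-! ### Extension by one degree and uniqueness -/

/-- Sewing extends a homomorphism from the trees of size `m` to those of size `m + 1`.  The
constants are preserved because the factor `1 / (2 ^ (γ |τ|) - 2)` of the sewing lemma is the one
in the recursion for the weights. -/
theorem exists_extension_succ {γ A B : ℝ} (hγ : 0 < γ) (hA : 0 ≤ A) (hB₀ : 0 ≤ B) (hB₁ : B ≤ 1)
    {m : ℕ} (hm : 1 < γ * (m + 1)) {Y : TreeAlg L →ₐ[ℝ] Fun2 T} (hY : IsChen m Y)
    (hYb : TreeBound γ A B m Y) :
    ∃ Y' : TreeAlg L →ₐ[ℝ] Fun2 T, IsChen (m + 1) Y' ∧ TreeBound γ A B (m + 1) Y' ∧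
      ∀ τ : LTree L, τ.size ≤ m → Y' (MvPolynomial.X τ) = Y (MvPolynomial.X τ) := by
  have step : ∀ τ : LTree L, τ.size = m + 1 → ∃ g : Fun2 T,
      (∀ t u s, coboundary g t u s = reducedSum (charAt Y t u) (charAt Y u s) τ) ∧
      ∀ t s, |g t s| ≤ B * A ^ τ.size * qTree γ τ * |(t : ℝ) - s| ^ (γ * τ.size) := by
    intro τ hτ
    have hz : 1 < γ * τ.size := by rw [hτ]; push_cast; exact hm
    have hq : ¬ (τ.size : ℝ) ≤ 1 / γ := by
      rw [not_le, div_lt_iff₀ hγ]; linarith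
    obtain ⟨g, hg, hgb⟩ := exists_coboundary_eq hz
      (h := fun t u s => reducedSum (charAt Y t u) (charAt Y u s) τ)
      (C := B * A ^ τ.size * (τ.reducedTerms.map fun p => q γ p.1 * q γ p.2).sum)
      (fun t u v s => hY.cocycle hτ t u v s) (fun t u s d h1 h2 => by
        have hd : 0 ≤ d := (abs_nonneg _).trans h1
        rw [← mul_rpow_pow γ A B _ hd]
        have mono : ∀ t s : Set.Icc (0 : ℝ) T, |(t : ℝ) - s| ≤ d → ∀ ρ : LTree L,
            ρ.size < τ.size → |charAt Y t s (MvPolynomial.X ρ)|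
              ≤ B * ((A * d ^ γ) ^ ρ.size * qTree γ ρ) := by
          intro t s hts ρ hρ
          refine (hYb ρ (by omega) t s).trans ?_
          have := qTree_nonneg hγ ρ
          gcongr
        exact abs_reducedSum_le hγ hB₀ hB₁ (mul_nonneg hA (Real.rpow_nonneg hd γ))
          (mono t u h1) (mono u s h2))
    refine ⟨g, hg, fun t s => (hgb t s).trans (le_of_eq ?_)⟩
    rw [qTree_eq hq]
    ring
  choose g hg hgb using step
  let Y' : TreeAlg L →ₐ[ℝ] Fun2 T := MvPolynomial.aeval fun τ =>
    if h : τ.size = m + 1 then g τ h else Y (MvPolynomial.X τ)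
  have hlow : ∀ τ : LTree L, τ.size ≤ m → Y' (MvPolynomial.X τ) = Y (MvPolynomial.X τ) := by
    intro τ hτ
    rw [MvPolynomial.aeval_X, dif_neg (by omega)]
  have htop : ∀ (τ : LTree L) (h : τ.size = m + 1), Y' (MvPolynomial.X τ) = g τ h := by
    intro τ hτ
    rw [MvPolynomial.aeval_X, dif_pos hτ]
  have hred : ∀ τ : LTree L, τ.size ≤ m + 1 → ∀ t u s,
      reducedSum (charAt Y' t u) (charAt Y' u s) τ
        = reducedSum (charAt Y t u) (charAt Y u s) τ := fun τ hτ t u s =>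
    reducedSum_congr (fun ρ hρ => by rw [charAt_apply, charAt_apply, hlow ρ (by omega)])
      fun ρ hρ => by rw [charAt_apply, charAt_apply, hlow ρ (by omega)]
  refine ⟨Y', fun τ hτ t u s => ?_, fun τ hτ t s => ?_, hlow⟩
  · rw [hred τ hτ]
    rcases Nat.le_succ_iff.1 hτ with h | h
    · rw [hlow τ h, hY τ h]
    · rw [htop τ h, hg τ h]
  · rcases Nat.le_succ_iff.1 hτ with h | h
    · rw [hlow τ h]
      exact hYb τ h t s
    · rw [htop τ h, mul_rpow_pow γ A B _ (abs_nonneg _)]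
      exact hgb τ h t s

/-- Two extensions agree: their difference on the first tree where they differ would be an
additive increment of exponent greater than `1`. -/
theorem eq_of_isChen {γ A B A' B' : ℝ} (hγ : 0 < γ) {n m : ℕ} (hn : 1 < γ * (n + 1))
    {Y Z : TreeAlg L →ₐ[ℝ] Fun2 T} (hY : IsChen m Y) (hZ : IsChen m Z)
    (hYb : TreeBound γ A B m Y) (hZb : TreeBound γ A' B' m Z)
    (h : ∀ τ : LTree L, τ.size ≤ n → Y (MvPolynomial.X τ) = Z (MvPolynomial.X τ))
    (τ : LTree L) (hτ : τ.size ≤ m) : Y (MvPolynomial.X τ) = Z (MvPolynomial.X τ) := by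
  induction hk : τ.size using Nat.strong_induction_on generalizing τ with
  | _ k ih =>
  rcases le_or_gt τ.size n with hle | hlt
  · exact h τ hle
  have hz : 1 < γ * τ.size := by
    have : (n : ℝ) + 1 ≤ τ.size := by exact_mod_cast hlt
    exact hn.trans_le (mul_le_mul_of_nonneg_left this hγ.le)
  have hred : ∀ t u s, reducedSum (charAt Y t u) (charAt Y u s) τ
      = reducedSum (charAt Z t u) (charAt Z u s) τ := fun t u s =>
    reducedSum_congr
      (fun ρ hρ => by rw [charAt_apply, charAt_apply, ih _ (hk ▸ hρ) ρ (by omega) rfl])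
      fun ρ hρ => by rw [charAt_apply, charAt_apply, ih _ (hk ▸ hρ) ρ (by omega) rfl]
  have key := abs_le_of_coboundary_midpoint hz (c := 0)
    (K := B * A ^ τ.size * qTree γ τ + B' * A' ^ τ.size * qTree γ τ)
    (g := Y (MvPolynomial.X τ) - Z (MvPolynomial.X τ)) (fun t s => by
      have h1 := hYb τ hτ t s
      have h2 := hZb τ hτ t s
      rw [mul_rpow_pow _ _ _ _ (abs_nonneg _)] at h1 h2
      rw [add_mul]
      exact (abs_sub _ _).trans (add_le_add h1 h2)) (fun t u s _ _ => by
      have h1 := hY τ hτ t u s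
      have h2 := hZ τ hτ t u s
      rw [hred, ← h2] at h1
      have h3 : coboundary (Y (MvPolynomial.X τ) - Z (MvPolynomial.X τ)) t u s = 0 := by
        simp only [coboundary, Pi.sub_apply] at h1 ⊢
        linarith
      rw [h3, abs_zero, zero_mul])
  funext t s
  have := key t s
  rw [zero_div, zero_mul] at this
  exact sub_eq_zero.1 (abs_nonpos_iff.1 this)

/-! ### Partial homomorphisms and extension to all degrees -/

/-- A partial homomorphism is the restriction of an algebra homomorphism. -/
theorem IsPartialHom.exists_algHom {n : ℕ} {X : TreeAlgLE L n →ₗ[ℝ] Fun2 T}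
    (hX : IsPartialHom X) :
    ∃ Y : TreeAlg L →ₐ[ℝ] Fun2 T, ∀ x : TreeAlgLE L n, Y (x : TreeAlg L) = X x := by
  let Y : TreeAlg L →ₐ[ℝ] Fun2 T := MvPolynomial.aeval fun τ =>
    if h : τ.size ≤ n then X ⟨MvPolynomial.X τ, LTree.X_mem h⟩ else 0
  have hmon : ∀ (σ : Forest L) (h : σ.size ≤ n), Y σ.mon = X ⟨σ.mon, Forest.mon_mem h⟩ := by
    intro σ
    induction σ using Multiset.induction with
    | empty =>
      intro h
      rw [hX.map_one, Forest.mon_zero, _root_.map_one]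
    | cons τ σ ih =>
      intro h
      have h' := h
      rw [Forest.size_cons] at h'
      have hτ : τ.size ≤ n := by omega
      have e := hX.map_mul {τ} σ h (by simpa [Forest.size] using hτ) (by omega)
      have e2 : Forest.mon {τ} = MvPolynomial.X τ := by simp [Forest.mon]
      simp only [Multiset.singleton_add, e2] at e
      rw [e, Forest.mon_cons, _root_.map_mul, ih (by omega), MvPolynomial.aeval_X, dif_pos hτ]
  refine ⟨Y, fun ⟨x, hx⟩ => ?_⟩
  change Y x = X ⟨x, hx⟩
  induction hx using Submodule.span_induction with
  | mem x h =>
    obtain ⟨σ, hσ, rfl⟩ := h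
    exact hmon σ hσ
  | zero => rw [map_zero]; exact (map_zero X).symm
  | add x y hx hy h1 h2 => rw [map_add, h1, h2, ← map_add]; rfl
  | smul c x hx h1 => rw [map_smul, h1, ← map_smul]; rfl

theorem IsPartialHom.isChen {n : ℕ} {X : TreeAlgLE L n →ₗ[ℝ] Fun2 T} (hX : IsPartialHom X)
    {Y : TreeAlg L →ₐ[ℝ] Fun2 T} (hY : ∀ x : TreeAlgLE L n, Y (x : TreeAlg L) = X x) :
    IsChen n Y := by
  intro τ hτ t u s
  obtain ⟨w, hw, hδ⟩ := hX.delta ⟨MvPolynomial.X τ, LTree.X_mem hτ⟩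
  have hXY : X = Y.toLinearMap ∘ₗ (TreeAlgLE L n).subtype := LinearMap.ext fun x => (hY x).symm
  have h1 := hδ t u s
  rw [← hY] at h1
  rw [h1, hXY, extProd_comp, hw, extProd_toLinearMap, productMap_reducedCoproduct_X]

theorem eq_on_of_eq_on_trees {n : ℕ} {Y Z : TreeAlg L →ₐ[ℝ] Fun2 T}
    (h : ∀ τ : LTree L, τ.size ≤ n → Y (MvPolynomial.X τ) = Z (MvPolynomial.X τ))
    {x : TreeAlg L} (hx : x ∈ TreeAlgLE L n) : Y x = Z x := by
  have : Set.EqOn Y.toLinearMap Z.toLinearMap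
      {x | ∃ σ : Forest L, σ.size ≤ n ∧ x = Forest.mon σ} := by
    rintro _ ⟨σ, hσ, rfl⟩
    exact map_mon_congr h hσ
  exact LinearMap.eqOn_span this hx

/-- A homomorphism with Chen's relation and bounds up to degree `n` extends to all degrees: by
uniqueness, the extensions to the different degrees are compatible. -/
theorem exists_extension {γ A B : ℝ} (hγ : 0 < γ) (hA : 0 ≤ A) (hB₀ : 0 ≤ B) (hB₁ : B ≤ 1)
    {n : ℕ} (hn : 1 < γ * (n + 1)) {Y₀ : TreeAlg L →ₐ[ℝ] Fun2 T} (hY : IsChen n Y₀)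
    (hYb : TreeBound γ A B n Y₀) :
    ∃ Y : TreeAlg L →ₐ[ℝ] Fun2 T, (∀ m, IsChen m Y) ∧ (∀ m, TreeBound γ A B m Y) ∧
      ∀ τ : LTree L, τ.size ≤ n → Y (MvPolynomial.X τ) = Y₀ (MvPolynomial.X τ) := by
  have step : ∀ k : ℕ, ∃ Y : TreeAlg L →ₐ[ℝ] Fun2 T, IsChen (n + k) Y ∧
      TreeBound γ A B (n + k) Y ∧
      ∀ τ : LTree L, τ.size ≤ n → Y (MvPolynomial.X τ) = Y₀ (MvPolynomial.X τ) := by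
    intro k
    induction k with
    | zero => exact ⟨Y₀, hY, hYb, fun _ _ => rfl⟩
    | succ k ih =>
      obtain ⟨Y, h1, h2, h3⟩ := ih
      have hk : 1 < γ * ((n + k : ℕ) + 1) := by
        push_cast
        nlinarith [(Nat.cast_nonneg k : (0 : ℝ) ≤ k)]
      obtain ⟨Y', h1', h2', h3'⟩ := exists_extension_succ hγ hA hB₀ hB₁ hk h1 h2
      exact ⟨Y', h1', h2', fun τ hτ => (h3' τ (by omega)).trans (h3 τ hτ)⟩
  choose V hV hVb hV₀ using step
  let Y : TreeAlg L →ₐ[ℝ] Fun2 T := MvPolynomial.aeval fun τ => V τ.size (MvPolynomial.X τ)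
  have hYV : ∀ (k : ℕ) (τ : LTree L), τ.size ≤ k →
      Y (MvPolynomial.X τ) = V k (MvPolynomial.X τ) := by
    intro k τ hτ
    rw [MvPolynomial.aeval_X]
    exact eq_of_isChen hγ hn ((hV τ.size).mono (Nat.le_add_left _ _))
      ((hV k).mono (by omega)) ((hVb τ.size).mono (Nat.le_add_left _ _))
      ((hVb k).mono (by omega)) (fun ρ hρ => (hV₀ _ ρ hρ).trans (hV₀ _ ρ hρ).symm) τ le_rfl
  refine ⟨Y, fun m τ hτ t u s => ?_, fun m τ hτ t s => ?_, fun τ hτ => ?_⟩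
  · rw [hYV m τ hτ, hV m τ (by omega)]
    exact (reducedSum_congr
      (fun ρ hρ => by rw [charAt_apply, charAt_apply, hYV m ρ (by omega)])
      fun ρ hρ => by rw [charAt_apply, charAt_apply, hYV m ρ (by omega)]).symm
  · rw [hYV m τ hτ]
    exact hVb m τ (by omega) t s
  · rw [hYV τ.size τ le_rfl]
    exact hV₀ _ τ hτ

theorem IsBranchedRoughPath.exists_treeBound {γ : ℝ} (hγ : 0 < γ)
    {Z : TreeAlg L →ₐ[ℝ] Fun2 T} (hZ : IsBranchedRoughPath γ Z) :
    ∃ A B : ℝ, ∀ m, TreeBound γ A B m Z := by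
  obtain ⟨A, B, hA, hB, -, h⟩ := hZ.bound
  refine ⟨A, B, fun m τ _ t s => ?_⟩
  have h1 := h {τ} (by simp)
  simp only [Forest.mon, Forest.size, q, Multiset.map_singleton, Multiset.prod_singleton,
    Multiset.sum_singleton] at h1
  rw [mul_rpow_pow _ _ _ _ (abs_nonneg _)]
  exact abs_le_of_holderNorm_le
    (mul_nonneg (mul_nonneg hB (pow_nonneg hA _)) (qTree_nonneg hγ τ)) (hZ.mem_incr τ) h1 t s

theorem isBranchedRoughPath_of_isChen {γ A B : ℝ} (hγ : 0 < γ) (hA : 0 ≤ A) (hB₀ : 0 ≤ B)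
    (hB₁ : B ≤ 1) {Y : TreeAlg L →ₐ[ℝ] Fun2 T} (hY : ∀ m, IsChen m Y)
    (hYb : ∀ m, TreeBound γ A B m Y) : IsBranchedRoughPath γ Y where
  mem_incr τ := (hYb τ.size).mem_incr hγ le_rfl
  delta := delta_of_isChen hY
  bound := by
    refine ⟨A, B, hA, hB₀, hB₁, fun σ hσ => holderNorm_le_of_abs_le
      (mul_nonneg (mul_nonneg hB₀ (pow_nonneg hA _)) (q_nonneg hγ σ)) fun t s => ?_⟩
    rw [← mul_rpow_pow _ _ _ _ (abs_nonneg _)]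
    exact abs_mon_le hγ hB₀ hB₁ (mul_nonneg hA (Real.rpow_nonneg (abs_nonneg _) γ))
      (φ := charAt Y t s) (fun τ hτ => hYb σ.size τ hτ t s) hσ le_rfl

end Branched

open Branched in
theorem mainTheorem2 {L : Type*} [Finite L] {T : ℝ} (hT : 0 < T) (n : ℕ) (γ A B : ℝ)
    (hγ : 0 < γ) (hn : 1 < γ * (n + 1)) (hA : 0 ≤ A) (hB₀ : 0 ≤ B) (hB₁ : B ≤ 1)
    (X : TreeAlgLE L n →ₗ[ℝ] Fun2 T) (hX : IsPartialHom X)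
    (hbound : ∀ (τ : LTree L) (h : τ.size ≤ n),
      holderNorm (γ * τ.size) (X ⟨MvPolynomial.X τ, LTree.X_mem h⟩)
        ≤ ENNReal.ofReal (B * A ^ τ.size * qTree γ τ)) :
    ∃ Y : TreeAlg L →ₐ[ℝ] Fun2 T,
      (IsBranchedRoughPath γ Y ∧ (∀ x : TreeAlgLE L n, Y (x : TreeAlg L) = X x)) ∧
      (∀ τ : LTree L, holderNorm (γ * τ.size) (Y (MvPolynomial.X τ))
        ≤ ENNReal.ofReal (B * A ^ τ.size * qTree γ τ)) ∧
      ∀ Z : TreeAlg L →ₐ[ℝ] Fun2 T, IsBranchedRoughPath γ Z →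
        (∀ x : TreeAlgLE L n, Z (x : TreeAlg L) = X x) → Z = Y := by
  have hc : ∀ τ : LTree L, 0 ≤ B * A ^ τ.size * qTree γ τ := fun τ =>
    mul_nonneg (mul_nonneg hB₀ (pow_nonneg hA _)) (qTree_nonneg hγ τ)
  obtain ⟨Y₀, hY₀⟩ := hX.exists_algHom
  have hb₀ : TreeBound γ A B n Y₀ := by
    intro τ hτ t s
    rw [mul_rpow_pow _ _ _ _ (abs_nonneg _)]
    have := abs_le_of_holderNorm_le (hc τ) (hX.mem_incr τ hτ) (hbound τ hτ) t s
    rwa [← hY₀] at this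
  obtain ⟨Y, hY, hYb, hYY₀⟩ := exists_extension hγ hA hB₀ hB₁ hn (hX.isChen hY₀) hb₀
  refine ⟨Y, ⟨isBranchedRoughPath_of_isChen hγ hA hB₀ hB₁ hY hYb, fun x => ?_⟩, fun τ => ?_,
    fun Z hZ hZX => ?_⟩
  · exact (eq_on_of_eq_on_trees hYY₀ x.2).trans (hY₀ x)
  · refine holderNorm_le_of_abs_le (hc τ) fun t s => ?_
    rw [← mul_rpow_pow _ _ _ _ (abs_nonneg _)]
    exact hYb τ.size τ le_rfl t s
  · obtain ⟨A', B', hZb⟩ := hZ.exists_treeBound hγ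
    refine MvPolynomial.algHom_ext fun τ => ?_
    refine eq_of_isChen hγ hn (isChen_of_delta hZ.delta τ.size) (hY τ.size) (hZb τ.size)
      (hYb τ.size) (fun ρ hρ => ?_) τ le_rfl
    rw [hYY₀ ρ hρ]
    exact (hZX ⟨_, LTree.X_mem hρ⟩).trans (hY₀ ⟨_, LTree.X_mem hρ⟩).symm
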